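/- Let $(X,Y)$ be a random vector in $\mathbf R^d\times\mathbf R^m$, $d\ge 1$, with law $Q$ and $X\in\mathcal X\subseteq\mathbf R^d$ almost surely. Assume that $Q$ has a density $f(x,y)\ge 0$ with respect to $dx\otimes\nu(dy)$, where $dx$ is Lebesgue measure and $\nu$ is a $\sigma$-finite measure on $\mathbf R^m$, and let $g(x)=\int f(x,y)\,\nu(dy)$. Fix $x_0\in\mathcal X$, let $B_r$ be the open Euclidean ball of radius $r$ around $x_0$, let $P_r$ be the law of $Y$ conditional on $X\in B_r$, and let $P$ be the conditional law of $Y$ given $X=x_0$, i.e. the law with $\nu$-density $f(x_0,\cdot)/g(x_0)$. Assume: (i) $g(x_0)>0$, and there is $C_g<\infty$ with $|g(x)-g(x_0)|\le C_g\|x-x_0\|$ for all $x\in\mathcal X$ in a neighborhood of $x_0$; (ii) there are $C_{x_0}>0$ and $r_0>0$ with $\mathrm{Vol}(B_r\cap\mathcal X)\ge C_{x_0}r^d$ for all $0<r<r_0$. For $1\le k\le n$ let $(X_1,Y_1),\dots,(X_n,Y_n)$ be i.i.d. with law $Q$, let $S_n=(Y_{\iota(1)},\dots,Y_{\iota(k)})$,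 where $\iota(1)<\dots<\iota(k)$ are the indices of the $k$ observations with the smallest distances $\|X_i-x_0\|$ (ties have probability zero), and let $S=(S_1,\dots,S_k)$ with $S_1,\dots,S_k$ i.i.d. with law $P$. Let $\mathcal L(\cdot)$ denote the law of a random vector, $\mathrm{TV}(\mu,\mu')=\sup_B|\mu(B)-\mu'(B)|$, and $\mathrm H^2(\mu,\mu')=\tfrac12\int(\sqrt{p}-\sqrt{p'})^2\,d\rho$, where $p,p'$ are the densities of $\mu,\mu'$ with respect to a dominating measure $\rho$. Suppose that, as $r\downarrow 0$, $\mathrm H(P_r,P)=O(r^{a_h})$ for some $a_h\ge 0$ and $\mathrm{TV}(P_r,P)=O(r^{a_{tv}})$ for some $a_{tv}\ge 0$. Then there is a constant $C<\infty$, not depending on $n$ and $k$, such that for all $n\ge1$ and all $k\in\{1,\dots,n\}$: (a) $\mathrm H(\mathcal L(S_n),\mathcal L(S))\le C\,k^{1/2}(k/n)^{a_h/d}$; (b) $\mathrm{TV}(\mathcal L(S_n),\mathcal L(S))\le C\min\{k(k/n)^{a_{tv}/d},\;k^{1/2}(k/n)^{a_h/d}\}$. -/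

import Mathlib

open MeasureTheory ProbabilityTheory Filter Topology Asymptotics

noncomputable section

namespace InducedOrder

/-! ### Distances between laws -/

/-- Total variation distance: the supremum of `|μ B - ν B|` over measurable sets `B`. -/
def tvDist {α : Type*} [MeasurableSpace α] (μ ν : Measure α) : ℝ :=
  ⨆ B : {B : Set α // MeasurableSet B}, |μ.real B - ν.real B|

/-- Hellinger distance, `H(μ, ν)² = (1/2) ∫ (√p - √q)² dρ` where `p`, `q` are the densities of `μ`, `ν`
with respect to the dominating measure `ρ = μ + ν` (the value is the same for every dominating `ρ`). -/
def hellinger {α : Type*} [MeasurableSpace α] (μ ν : Measure α) : ℝ :=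
  √((1 / 2) * ∫ y, (√((μ.rnDeriv (μ + ν) y).toReal) - √((ν.rnDeriv (μ + ν) y).toReal)) ^ 2 ∂(μ + ν))

/-! ### The model -/

variable {d m : ℕ}

/-- `f` is a nonnegative measurable version of the density of `Q` with respect to `dx ⊗ ν(dy)`. -/
structure IsJointDensity (Q : Measure (EuclideanSpace ℝ (Fin d) × EuclideanSpace ℝ (Fin m)))
    (ν : Measure (EuclideanSpace ℝ (Fin m)))
    (f : EuclideanSpace ℝ (Fin d) → EuclideanSpace ℝ (Fin m) → ℝ) : Prop where
  measurable : Measurable (Function.uncurry f)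
  nonneg : ∀ x y, 0 ≤ f x y
  eq_withDensity : Q = (volume.prod ν).withDensity (fun z => ENNReal.ofReal (f z.1 z.2))

/-- The marginal density `g(x) = ∫ f(x, y) ν(dy)` of `X`. -/
def marginalDensity (ν : Measure (EuclideanSpace ℝ (Fin m)))
    (f : EuclideanSpace ℝ (Fin d) → EuclideanSpace ℝ (Fin m) → ℝ)
    (x : EuclideanSpace ℝ (Fin d)) : ℝ :=
  ∫ y, f x y ∂ν

/-- The conditional law of `Y` given `X = x`, with `ν`-density `p_x(y) = f(x, y) / g(x)`. -/
def condLaw (ν : Measure (EuclideanSpace ℝ (Fin m)))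
    (f : EuclideanSpace ℝ (Fin d) → EuclideanSpace ℝ (Fin m) → ℝ)
    (x : EuclideanSpace ℝ (Fin d)) : Measure (EuclideanSpace ℝ (Fin m)) :=
  ν.withDensity (fun y => ENNReal.ofReal (f x y / marginalDensity ν f x))

/-- The law `P_r` of `Y` conditional on the event `X ∈ B_r`, where `B_r` is the open ball of radius `r`
around `x₀` and `(X, Y)` has law `Q`. -/
def localLaw (Q : Measure (EuclideanSpace ℝ (Fin d) × EuclideanSpace ℝ (Fin m)))
    (x₀ : EuclideanSpace ℝ (Fin d)) (r : ℝ) : Measure (EuclideanSpace ℝ (Fin m)) :=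
  (Q[|Prod.fst ⁻¹' Metric.ball x₀ r]).map Prod.snd

/-- Local regularity of the density `g` of `X` at `x₀`: `g(x₀) > 0`, `g` is Lipschitz at `x₀` along `𝒳`,
and `𝒳` fills at least a fixed fraction of every small ball around `x₀`. -/
structure LocallyRegular (𝒳 : Set (EuclideanSpace ℝ (Fin d))) (g : EuclideanSpace ℝ (Fin d) → ℝ)
    (x₀ : EuclideanSpace ℝ (Fin d)) : Prop where
  pos : 0 < g x₀
  lipschitz : ∃ C : ℝ, ∀ᶠ x in 𝓝[𝒳] x₀, |g x - g x₀| ≤ C * ‖x - x₀‖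
  thick : ∃ C > 0, ∃ r₀ > 0, ∀ r : ℝ, 0 < r → r < r₀ →
    C * r ^ d ≤ volume.real (Metric.ball x₀ r ∩ 𝒳)

/-! ### Induced order statistics -/

/-- The rank permutation `σ` of distances `R`: `σ i = j` means that `R i` is the `j`-th order statistic
(ranks start at `0`). Ties, which have probability zero in the model, are broken by the index. -/
def rankPerm {n : ℕ} (R : Fin n → ℝ) : Equiv.Perm (Fin n) :=
  (Tuple.sort R).symm

/-- The set of the indices of the `k` smallest distances. -/
def nearest {n : ℕ} (R : Fin n → ℝ) (k : ℕ) : Finset (Fin n) :=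
  Finset.univ.filter fun i => (rankPerm R i : ℕ) < k

theorem card_nearest {n : ℕ} (R : Fin n → ℝ) {k : ℕ} (hk : k ≤ n) : (nearest R k).card = k := by
  have h : nearest R k = (Finset.univ.filter fun j : Fin n => (j : ℕ) < k).map
      (rankPerm R).symm.toEmbedding := by
    ext i
    simp [nearest, Finset.mem_map_equiv]
  rw [h, Finset.card_map, Fin.card_filter_val_lt, min_eq_right hk]

/-- The induced order statistics `S_n = (Y_{ι(1)}, …, Y_{ι(k)})` of a sample `z` of points `(X_i, Y_i)`:
the responses of the `k` observations closest to `x₀`, listed in the original sample order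
(`ι` is the increasing enumeration of the set of nearest indices). -/
def inducedOrderStats (x₀ : EuclideanSpace ℝ (Fin d)) {n k : ℕ} (hk : k ≤ n)
    (z : Fin n → EuclideanSpace ℝ (Fin d) × EuclideanSpace ℝ (Fin m)) :
    Fin k → EuclideanSpace ℝ (Fin m) :=
  fun j => (z ((nearest (fun i => ‖(z i).1 - x₀‖) k).orderEmbOfFin (card_nearest _ hk) j)).2

/-- The law of `S_n` when `(X_1, Y_1), …, (X_n, Y_n)` are i.i.d. with law `Q`. -/
def lawSn (Q : Measure (EuclideanSpace ℝ (Fin d) × EuclideanSpace ℝ (Fin m)))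
    (x₀ : EuclideanSpace ℝ (Fin d)) {n k : ℕ} (hk : k ≤ n) :
    Measure (Fin k → EuclideanSpace ℝ (Fin m)) :=
  (Measure.pi fun _ : Fin n => Q).map (inducedOrderStats x₀ hk)

/-- The law of `S = (S_1, …, S_k)` with i.i.d. entries of law `P`. -/
def lawS (P : Measure (EuclideanSpace ℝ (Fin m))) (k : ℕ) :
    Measure (Fin k → EuclideanSpace ℝ (Fin m)) :=
  Measure.pi fun _ : Fin k => P

end InducedOrder

end

noncomputable section

namespace InducedOrder

open scoped ENNReal


/-! ### Product measures -/

/-! Given the `n - k` farther observations, let `r` be their smallest distance to `x₀`. The `k`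
nearest ones are then i.i.d. conditioned on `X ∈ B_r`. Up to ties, a `k`-subset is the nearest one
exactly when all its points lie within that distance, and by exchangeability every subset
contributes equally. Hence `S_n` is a mixture of products of `P_r`, with density `C(n,k) G(r)^k` on
the farther sample, where `G(r) = Q(X ∈ B_r)` (`lawSn_apply`).

Total variation between `k`-fold products is at most `k` times that between the factors, so mixing
gives the bound `k E[TV(P_R, P)]`. For Hellinger, `1 - H²` is the affinity, which is multiplicative
over products and concave in one argument. With Bernoulli's inequality, `H² ≤ k E[H²(P_R, P)]`, and
a square root gives the factor `k^{1/2}`.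

It remains to control the random radius `R`. Regularity at `x₀` gives `G(r) ≥ c r^d` for small `r`,
so a local rate `r^a` becomes a bound `K G(r)^{a/d}` (`exists_le_rpow_of_isBigO`). Integer moments
of `G(R)` are ratios of binomial coefficients, because the mixing density has total mass one for
every `k`; interpolation then gives `E[G(R)^p] ≤ C (k/n)^p` for real `p ≥ 0`. The minimum in (b)
follows from `TV ≤ 3 H`. -/

theorem lintegral_pi_prod {α : Type*} [MeasurableSpace α] {k : ℕ} (μ : Fin k → Measure α)
    [∀ i, SigmaFinite (μ i)] (g : Fin k → α → ℝ≥0∞) (hg : ∀ i, Measurable (g i)) :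
    ∫⁻ y, ∏ i, g i (y i) ∂Measure.pi μ = ∏ i, ∫⁻ y, g i y ∂μ i := by
  induction k with
  | zero => simp
  | succ k ih =>
    have h := (measurePreserving_piFinSuccAbove μ 0).symm
    rw [← h.lintegral_comp (by fun_prop)]
    simp only [MeasurableEquiv.piFinSuccAbove_symm_apply, Fin.insertNthEquiv,
      Fin.prod_univ_succ, Fin.insertNth_zero, Equiv.coe_fn_mk, Fin.cons_succ, Fin.zero_succAbove,
      cast_eq, Fin.cons_zero]
    rw [lintegral_prod_mul (hg 0).aemeasurable
      (by fun_prop : Measurable fun y : Fin k → α => ∏ i, g i.succ (y i)).aemeasurable,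
      ih (fun i => μ i.succ) (fun i => g i.succ) (fun i => hg _)]

theorem pi_withDensity {α : Type*} [MeasurableSpace α] {k : ℕ} (μ : Measure α) [SigmaFinite μ]
    (p : α → ℝ≥0∞) (hp : Measurable p) [SigmaFinite (μ.withDensity p)] :
    Measure.pi (fun _ : Fin k => μ.withDensity p)
      = (Measure.pi fun _ : Fin k => μ).withDensity (fun y => ∏ i, p (y i)) := by
  refine Measure.pi_eq fun s hs => ?_
  rw [withDensity_apply _ (MeasurableSet.univ_pi hs), Measure.restrict_pi_pi,
    lintegral_pi_prod _ (fun _ => p) (fun _ => hp)]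
  exact Finset.prod_congr rfl fun i _ => (withDensity_apply _ (hs i)).symm

/-! ### Hellinger distance -/

/-- The Hellinger affinity `∫ √(p q)` of two densities. -/
def affinity {α : Type*} [MeasurableSpace α] (ρ : Measure α) (p q : α → ℝ≥0∞) : ℝ≥0∞ :=
  ∫⁻ y, p y ^ (1 / 2 : ℝ) * q y ^ (1 / 2 : ℝ) ∂ρ

theorem rpow_half_mul_rpow_half (x : ℝ≥0∞) : x ^ (1 / 2 : ℝ) * x ^ (1 / 2 : ℝ) = x := by
  rw [← ENNReal.rpow_add_of_nonneg _ _ (by norm_num) (by norm_num)]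
  norm_num

theorem affinity_pi {α : Type*} [MeasurableSpace α] {k : ℕ} (ρ : Measure α) [SigmaFinite ρ]
    {p q : α → ℝ≥0∞} (hp : Measurable p) (hq : Measurable q) :
    affinity (Measure.pi fun _ : Fin k => ρ) (fun y => ∏ i, p (y i)) (fun y => ∏ i, q (y i))
      = affinity ρ p q ^ k := by
  unfold affinity
  simp_rw [← ENNReal.prod_rpow_of_nonneg (by norm_num : (0 : ℝ) ≤ 1 / 2),
    ← Finset.prod_mul_distrib]
  rw [lintegral_pi_prod (fun _ => ρ) (fun _ y => p y ^ (1 / 2 : ℝ) * q y ^ (1 / 2 : ℝ))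
    (fun _ => by fun_prop)]
  simp

/-- The affinity does not depend on the dominating measure: by the chain rule `p` and `q` are `p +
q` times the derivatives with respect to the sum, and the factor `√(p + q)` appears twice. This
permits computing with `ν` and its products. -/
theorem affinity_withDensity {α : Type*} [MeasurableSpace α] (ρ : Measure α) [SigmaFinite ρ]
    {p q : α → ℝ≥0∞} (hp : Measurable p) (hq : Measurable q)
    [IsFiniteMeasure (ρ.withDensity p)] [IsFiniteMeasure (ρ.withDensity q)] :
    affinity (ρ.withDensity p + ρ.withDensity q)
        ((ρ.withDensity p).rnDeriv (ρ.withDensity p + ρ.withDensity q))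
        ((ρ.withDensity q).rnDeriv (ρ.withDensity p + ρ.withDensity q)) = affinity ρ p q := by
  set μ := ρ.withDensity p
  set ν := ρ.withDensity q
  have hsum : μ + ν = ρ.withDensity (p + q) := (withDensity_add_left hp q).symm
  set a := μ.rnDeriv (μ + ν)
  set b := ν.rnDeriv (μ + ν)
  have ha : Measurable a := Measure.measurable_rnDeriv _ _
  have hb : Measurable b := Measure.measurable_rnDeriv _ _
  have hμ : (μ + ν).withDensity a = μ :=
    Measure.withDensity_rnDeriv_eq _ _ (Measure.absolutelyContinuous_of_le (Measure.le_add_right le_rfl))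
  have hν : (μ + ν).withDensity b = ν :=
    Measure.withDensity_rnDeriv_eq _ _ (Measure.absolutelyContinuous_of_le (Measure.le_add_left le_rfl))
  have h1 : (p + q) * a =ᵐ[ρ] p := by
    rw [← withDensity_eq_iff_of_sigmaFinite ((hp.add hq).mul ha).aemeasurable hp.aemeasurable,
      withDensity_mul _ (hp.add hq) ha, ← hsum, hμ]
  have h2 : (p + q) * b =ᵐ[ρ] q := by
    rw [← withDensity_eq_iff_of_sigmaFinite ((hp.add hq).mul hb).aemeasurable hq.aemeasurable,
      withDensity_mul _ (hp.add hq) hb, ← hsum, hν]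
  unfold affinity
  rw [hsum, lintegral_withDensity_eq_lintegral_mul _ (hp.add hq) (by fun_prop)]
  refine lintegral_congr_ae ?_
  filter_upwards [h1, h2] with y hy1 hy2
  rw [← hy1, ← hy2]
  simp only [Pi.mul_apply]
  rw [ENNReal.mul_rpow_of_nonneg _ _ (by norm_num), ENNReal.mul_rpow_of_nonneg _ _ (by norm_num)]
  conv_lhs => rw [← rpow_half_mul_rpow_half ((p + q) y)]
  ring

theorem hellinger_nonneg {α : Type*} [MeasurableSpace α] (μ ν : Measure α) :
    0 ≤ hellinger μ ν := Real.sqrt_nonneg _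

theorem hellinger_sq_eq {α : Type*} [MeasurableSpace α] (μ ν : Measure α) :
    hellinger μ ν ^ 2 = (1 / 2) * ∫ y, (√((μ.rnDeriv (μ + ν) y).toReal) -
      √((ν.rnDeriv (μ + ν) y).toReal)) ^ 2 ∂(μ + ν) :=
  Real.sq_sqrt (mul_nonneg (by norm_num) (integral_nonneg fun _ => sq_nonneg _))

theorem integral_toReal_rnDeriv_add {α : Type*} [MeasurableSpace α] (μ ν : Measure α)
    [IsFiniteMeasure μ] [IsFiniteMeasure ν] :
    ∫ y, (μ.rnDeriv (μ + ν) y).toReal ∂(μ + ν) = μ.real Set.univ ∧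
    ∫ y, (ν.rnDeriv (μ + ν) y).toReal ∂(μ + ν) = ν.real Set.univ :=
  ⟨Measure.integral_toReal_rnDeriv
      (Measure.absolutelyContinuous_of_le (Measure.le_add_right le_rfl)),
    Measure.integral_toReal_rnDeriv
      (Measure.absolutelyContinuous_of_le (Measure.le_add_left le_rfl))⟩

theorem sq_sub_sqrt_le {a b : ℝ} (ha : 0 ≤ a) (hb : 0 ≤ b) : (√a - √b) ^ 2 ≤ a + b := by
  nlinarith [Real.sq_sqrt ha, Real.sq_sqrt hb, Real.sqrt_nonneg a, Real.sqrt_nonneg b,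
    mul_nonneg (Real.sqrt_nonneg a) (Real.sqrt_nonneg b)]

theorem integrable_sq_sub_sqrt_rnDeriv {α : Type*} [MeasurableSpace α] (μ ν : Measure α)
    [IsFiniteMeasure μ] [IsFiniteMeasure ν] :
    Integrable (fun y => (√((μ.rnDeriv (μ + ν) y).toReal) -
      √((ν.rnDeriv (μ + ν) y).toReal)) ^ 2) (μ + ν) := by
  refine Integrable.mono' ((Measure.integrable_toReal_rnDeriv (μ := μ) (ν := μ + ν)).add
    (Measure.integrable_toReal_rnDeriv (μ := ν) (ν := μ + ν)))
    (Measurable.aestronglyMeasurable (by fun_prop)) (ae_of_all _ fun y => ?_)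
  rw [Real.norm_of_nonneg (sq_nonneg _)]
  exact sq_sub_sqrt_le ENNReal.toReal_nonneg ENNReal.toReal_nonneg

/-- The zero measure is admitted because `localLaw` vanishes when the ball has no mass. -/
theorem hellinger_le_one {α : Type*} [MeasurableSpace α] (μ ν : Measure α)
    [IsZeroOrProbabilityMeasure μ] [IsZeroOrProbabilityMeasure ν] : hellinger μ ν ≤ 1 := by
  have h : hellinger μ ν ^ 2 ≤ 1 := by
    rw [hellinger_sq_eq]
    have h1 := integral_mono (integrable_sq_sub_sqrt_rnDeriv μ ν)
      ((Measure.integrable_toReal_rnDeriv (μ := μ) (ν := μ + ν)).add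
        (Measure.integrable_toReal_rnDeriv (μ := ν) (ν := μ + ν)))
      (fun y => sq_sub_sqrt_le ENNReal.toReal_nonneg ENNReal.toReal_nonneg)
    have h2 := integral_toReal_rnDeriv_add μ ν
    rw [integral_add' Measure.integrable_toReal_rnDeriv Measure.integrable_toReal_rnDeriv,
      h2.1, h2.2] at h1
    have h3 : μ.real Set.univ ≤ 1 := measureReal_le_one
    have h4 : ν.real Set.univ ≤ 1 := measureReal_le_one
    linarith
  exact (sq_le_one_iff₀ (hellinger_nonneg _ _)).1 h

/-- Expand the square: the two densities integrate to one each and the cross term is the affinity.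
Written as a sum, the identity avoids truncated subtraction in `ℝ≥0∞`. -/
theorem hellinger_sq_add_affinity_rnDeriv {α : Type*} [MeasurableSpace α] (μ ν : Measure α)
    [IsProbabilityMeasure μ] [IsProbabilityMeasure ν] :
    ENNReal.ofReal (hellinger μ ν ^ 2)
      + affinity (μ + ν) (μ.rnDeriv (μ + ν)) (ν.rnDeriv (μ + ν)) = 1 := by
  set a := μ.rnDeriv (μ + ν) with ha
  set b := ν.rnDeriv (μ + ν) with hb
  have hma : Measurable a := Measure.measurable_rnDeriv _ _
  have hmb : Measurable b := Measure.measurable_rnDeriv _ _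
  have hia : Integrable (fun y => (a y).toReal) (μ + ν) := Measure.integrable_toReal_rnDeriv
  have hib : Integrable (fun y => (b y).toReal) (μ + ν) := Measure.integrable_toReal_rnDeriv
  have hi : Integrable (fun y => √((a y).toReal) * √((b y).toReal)) (μ + ν) := by
    refine Integrable.mono' (hia.add hib) (Measurable.aestronglyMeasurable (by fun_prop))
      (ae_of_all _ fun y => ?_)
    rw [Real.norm_of_nonneg (by positivity), Pi.add_apply]
    nlinarith [Real.sq_sqrt (ENNReal.toReal_nonneg (a := a y)),
      Real.sq_sqrt (ENNReal.toReal_nonneg (a := b y)),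
      sq_nonneg (√((a y).toReal) - √((b y).toReal)), ENNReal.toReal_nonneg (a := a y),
      ENNReal.toReal_nonneg (a := b y)]
  have haff : affinity (μ + ν) a b
      = ENNReal.ofReal (∫ y, √((a y).toReal) * √((b y).toReal) ∂(μ + ν)) := by
    rw [ofReal_integral_eq_lintegral_ofReal hi (ae_of_all _ fun y => by positivity)]
    refine lintegral_congr_ae ?_
    filter_upwards [μ.rnDeriv_lt_top (μ + ν), ν.rnDeriv_lt_top (μ + ν)] with y h1 h2
    rw [ENNReal.ofReal_mul (Real.sqrt_nonneg _), Real.sqrt_eq_rpow, Real.sqrt_eq_rpow,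
      ← ENNReal.ofReal_rpow_of_nonneg ENNReal.toReal_nonneg (by norm_num),
      ← ENNReal.ofReal_rpow_of_nonneg ENNReal.toReal_nonneg (by norm_num),
      ENNReal.ofReal_toReal h1.ne, ENNReal.ofReal_toReal h2.ne]
  rw [haff, ← ENNReal.ofReal_add (sq_nonneg _) (integral_nonneg fun y => by positivity),
    hellinger_sq_eq]
  have h2 := integral_toReal_rnDeriv_add μ ν
  rw [← ha, ← hb] at h2
  have : ∫ y, (√((a y).toReal) - √((b y).toReal)) ^ 2 ∂(μ + ν)
      = 2 - 2 * ∫ y, √((a y).toReal) * √((b y).toReal) ∂(μ + ν) := by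
    have he : ∀ y, (√((a y).toReal) - √((b y).toReal)) ^ 2
        = ((a y).toReal + (b y).toReal) - 2 * (√((a y).toReal) * √((b y).toReal)) := fun y => by
      rw [sub_sq, Real.sq_sqrt ENNReal.toReal_nonneg, Real.sq_sqrt ENNReal.toReal_nonneg]
      ring
    simp_rw [he]
    have hs : Integrable (fun y => (a y).toReal + (b y).toReal) (μ + ν) := hia.add hib
    rw [integral_sub hs (hi.const_mul 2), integral_add hia hib, integral_const_mul,
      h2.1, h2.2, probReal_univ, probReal_univ]
    norm_num
  rw [this, ← ENNReal.ofReal_one]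
  congr 1
  ring

theorem hellinger_sq_add_affinity {α : Type*} [MeasurableSpace α] (ρ : Measure α) [SigmaFinite ρ]
    {p q : α → ℝ≥0∞} (hp : Measurable p) (hq : Measurable q)
    [IsProbabilityMeasure (ρ.withDensity p)] [IsProbabilityMeasure (ρ.withDensity q)] :
    ENNReal.ofReal (hellinger (ρ.withDensity p) (ρ.withDensity q) ^ 2) + affinity ρ p q = 1 := by
  rw [← affinity_withDensity ρ hp hq, hellinger_sq_add_affinity_rnDeriv]

/-- The affinity is concave in its first argument. -/
theorem lintegral_affinity_le {α β : Type*} [MeasurableSpace α] [MeasurableSpace β]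
    (ρ : Measure α) [SigmaFinite ρ] (M : Measure β) [IsProbabilityMeasure M]
    {p : β → α → ℝ≥0∞} (hp : Measurable (Function.uncurry p)) {q : α → ℝ≥0∞} (hq : Measurable q) :
    ∫⁻ w, affinity ρ (p w) q ∂M ≤ affinity ρ (fun y => ∫⁻ w, p w y ∂M) q := by
  unfold affinity
  have hp1 : Measurable fun z : β × α => p z.1 z.2 := hp
  rw [lintegral_lintegral_swap (by
    refine Measurable.aemeasurable ?_
    exact (hp1.pow_const _).mul ((hq.comp measurable_snd).pow_const _))]
  refine lintegral_mono fun y => ?_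
  have hpy : Measurable fun w => p w y := hp1.comp (measurable_id.prodMk measurable_const)
  rw [lintegral_mul_const _ (hpy.pow_const _)]
  gcongr
  -- Cauchy–Schwarz against the constant `1`, that is, Jensen's inequality for the square root.
  have h := ENNReal.lintegral_mul_le_Lp_mul_Lq M (p := 2) (q := 2) ⟨by norm_num, by norm_num, by norm_num⟩
    (f := fun w => p w y ^ (1 / 2 : ℝ)) (g := fun _ => 1) (hpy.pow_const _).aemeasurable
    aemeasurable_const
  simp only [Pi.mul_apply, mul_one, ← ENNReal.rpow_mul] at h
  norm_num at h
  simpa using h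

/-- Bernoulli's inequality `(1 - b)^k ≥ 1 - k b` without subtraction; `x` will be an affinity and
`b` a bound on `H²`. -/
theorem one_le_pow_add_mul {k : ℕ} {x b : ℝ≥0∞} (h : 1 ≤ x + b) : 1 ≤ x ^ k + k * b := by
  induction k with
  | zero => simp
  | succ k ih =>
    rcases le_total 1 x with hx | hx
    · exact le_add_right (one_le_pow₀ hx)
    · calc (1 : ℝ≥0∞) ≤ x + b := h
        _ ≤ x * (x ^ k + k * b) + b := by
          gcongr
          exact le_mul_of_one_le_right' ih
        _ = x ^ (k + 1) + x * (k * b) + b := by ring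
        _ ≤ x ^ (k + 1) + 1 * (k * b) + b := by gcongr
        _ = _ := by push_cast; ring

/-! ### Total variation distance -/

theorem tvDist_nonneg {α : Type*} [MeasurableSpace α] (μ ν : Measure α) : 0 ≤ tvDist μ ν :=
  Real.iSup_nonneg fun _ => abs_nonneg _

theorem abs_measureReal_sub_le_one {α : Type*} [MeasurableSpace α] (μ ν : Measure α)
    [IsZeroOrProbabilityMeasure μ] [IsZeroOrProbabilityMeasure ν] (B : Set α) :
    |μ.real B - ν.real B| ≤ 1 := by
  have h1 : μ.real B ≤ 1 := measureReal_le_one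
  have h2 : ν.real B ≤ 1 := measureReal_le_one
  have h3 : 0 ≤ μ.real B := measureReal_nonneg
  have h4 : 0 ≤ ν.real B := measureReal_nonneg
  rw [abs_le]
  constructor <;> linarith

theorem tvDist_le_one {α : Type*} [MeasurableSpace α] (μ ν : Measure α)
    [IsZeroOrProbabilityMeasure μ] [IsZeroOrProbabilityMeasure ν] : tvDist μ ν ≤ 1 :=
  have : Nonempty {B : Set α // MeasurableSet B} := ⟨⟨∅, MeasurableSet.empty⟩⟩
  ciSup_le fun B => abs_measureReal_sub_le_one μ ν B

theorem abs_sub_le_tvDist {α : Type*} [MeasurableSpace α] (μ ν : Measure α)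
    [IsZeroOrProbabilityMeasure μ] [IsZeroOrProbabilityMeasure ν] {B : Set α}
    (hB : MeasurableSet B) : |μ.real B - ν.real B| ≤ tvDist μ ν :=
  le_ciSup (f := fun B : {B : Set α // MeasurableSet B} => |μ.real B - ν.real B|)
    ⟨1, by rintro _ ⟨B, rfl⟩; exact abs_measureReal_sub_le_one μ ν B⟩ ⟨B, hB⟩

theorem measure_le_add_tvDist {α : Type*} [MeasurableSpace α] (μ ν : Measure α)
    [IsProbabilityMeasure μ] [IsProbabilityMeasure ν] {B : Set α} (hB : MeasurableSet B) :
    μ B ≤ ν B + ENNReal.ofReal (tvDist μ ν) := by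
  have h := le_of_abs_le (abs_sub_le_tvDist μ ν hB)
  rw [← ofReal_measureReal, ← ofReal_measureReal (μ := ν),
    ← ENNReal.ofReal_add measureReal_nonneg (tvDist_nonneg _ _)]
  exact ENNReal.ofReal_le_ofReal (by linarith)

/-- A one-sided bound on all measurable sets suffices, by passing to complements. -/
theorem tvDist_le_of_forall_sub_le {α : Type*} [MeasurableSpace α] (μ ν : Measure α)
    [IsProbabilityMeasure μ] [IsProbabilityMeasure ν] {c : ℝ}
    (h : ∀ B, MeasurableSet B → μ.real B - ν.real B ≤ c) : tvDist μ ν ≤ c := by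
  have : Nonempty {B : Set α // MeasurableSet B} := ⟨⟨∅, MeasurableSet.empty⟩⟩
  refine ciSup_le fun ⟨B, hB⟩ => abs_le.2 ⟨?_, h B hB⟩
  have := h Bᶜ hB.compl
  rw [probReal_compl_eq_one_sub hB, probReal_compl_eq_one_sub hB] at this
  linarith

/-- Replace one factor at a time: first `μ'` by `ν'` on vertical slices, then `μ` by `ν` on
horizontal ones. Each exchange costs its own error. -/
theorem prod_apply_le_add {α β : Type*} [MeasurableSpace α] [MeasurableSpace β]
    (μ ν : Measure α) [IsProbabilityMeasure μ] [IsProbabilityMeasure ν]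
    (μ' ν' : Measure β) [IsProbabilityMeasure μ'] [IsProbabilityMeasure ν'] {c c' : ℝ≥0∞}
    (h : ∀ B, MeasurableSet B → μ B ≤ ν B + c) (h' : ∀ B, MeasurableSet B → μ' B ≤ ν' B + c')
    {B : Set (α × β)} (hB : MeasurableSet B) : μ.prod μ' B ≤ ν.prod ν' B + (c + c') :=
  calc μ.prod μ' B = ∫⁻ x, μ' (Prod.mk x ⁻¹' B) ∂μ := Measure.prod_apply hB
    _ ≤ ∫⁻ x, (ν' (Prod.mk x ⁻¹' B) + c') ∂μ :=
      lintegral_mono fun x => h' _ (measurable_prodMk_left hB)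
    _ = μ.prod ν' B + c' := by
      rw [lintegral_add_right _ measurable_const, Measure.prod_apply hB]
      simp
    _ = ∫⁻ y, μ ((fun x => (x, y)) ⁻¹' B) ∂ν' + c' := by rw [Measure.prod_apply_symm hB]
    _ ≤ ∫⁻ y, (ν ((fun x => (x, y)) ⁻¹' B) + c) ∂ν' + c' := by
      gcongr with y
      exact h _ (measurable_prodMk_right hB)
    _ = ν.prod ν' B + (c + c') := by
      rw [lintegral_add_right _ measurable_const, Measure.prod_apply_symm hB]
      simp [add_assoc]

theorem pi_apply_le_add {α : Type*} [MeasurableSpace α] (μ ν : Measure α)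
    [IsProbabilityMeasure μ] [IsProbabilityMeasure ν] {c : ℝ≥0∞}
    (h : ∀ B, MeasurableSet B → μ B ≤ ν B + c) (k : ℕ) :
    ∀ B : Set (Fin k → α), MeasurableSet B →
      Measure.pi (fun _ => μ) B ≤ Measure.pi (fun _ => ν) B + k * c := by
  induction k with
  | zero =>
    intro B _
    rw [Measure.pi_of_empty _ default, Measure.pi_of_empty _ default]
    simp
  | succ k ih =>
    intro B hB
    have h1 := (measurePreserving_piFinSuccAbove (fun _ : Fin (k + 1) => μ) 0).symm
    have h2 := (measurePreserving_piFinSuccAbove (fun _ : Fin (k + 1) => ν) 0).symm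
    rw [← h1.measure_preimage_equiv, ← h2.measure_preimage_equiv]
    refine (prod_apply_le_add μ ν _ _ h ih
      ((MeasurableEquiv.measurable _) hB)).trans_eq ?_
    push_cast
    ring

/-! ### Comparison of total variation with Hellinger distance -/

theorem measureReal_sub_eq_setIntegral {α : Type*} [MeasurableSpace α] (μ ν : Measure α)
    [IsFiniteMeasure μ] [IsFiniteMeasure ν] (B : Set α) :
    μ.real B - ν.real B = ∫ y in B, ((μ.rnDeriv (μ + ν) y).toReal
      - (ν.rnDeriv (μ + ν) y).toReal) ∂(μ + ν) := by
  rw [integral_sub Measure.integrable_toReal_rnDeriv.integrableOn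
    Measure.integrable_toReal_rnDeriv.integrableOn,
    Measure.setIntegral_toReal_rnDeriv
      (Measure.absolutelyContinuous_of_le (Measure.le_add_right le_rfl)),
    Measure.setIntegral_toReal_rnDeriv
      (Measure.absolutelyContinuous_of_le (Measure.le_add_left le_rfl))]

/-- Young's inequality with weight `t` for `a - b = (√a - √b)(√a + √b)`, together with `(√a + √b)² ≤
2(a + b)`. -/
theorem sub_le_sq_sub_sqrt {a b t : ℝ} (ha : 0 ≤ a) (hb : 0 ≤ b) (ht : 0 < t) :
    a - b ≤ (1 / (2 * t)) * (√a - √b) ^ 2 + t * (a + b) := by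
  have h1 := Real.sq_sqrt ha
  have h2 := Real.sq_sqrt hb
  set x := √a
  set y := √b
  rw [← h1, ← h2, ← sub_nonneg]
  have : (1 / (2 * t)) * (x - y) ^ 2 + t * (x ^ 2 + y ^ 2) - (x ^ 2 - y ^ 2)
      = (1 / (2 * t)) * ((x - y) - t * (x + y)) ^ 2 + (t / 2) * (x - y) ^ 2 := by
    field_simp
    ring
  rw [this]
  positivity

theorem tvDist_le_hellinger {α : Type*} [MeasurableSpace α] (μ ν : Measure α)
    [IsProbabilityMeasure μ] [IsProbabilityMeasure ν] : tvDist μ ν ≤ 3 * hellinger μ ν := by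
  have key : ∀ t : ℝ, 0 < t → tvDist μ ν ≤ hellinger μ ν ^ 2 / t + 2 * t := by
    intro t ht
    refine tvDist_le_of_forall_sub_le μ ν fun B hB => ?_
    have hi := integrable_sq_sub_sqrt_rnDeriv μ ν
    have hia : Integrable (fun y => (μ.rnDeriv (μ + ν) y).toReal) (μ + ν) :=
      Measure.integrable_toReal_rnDeriv
    have hib : Integrable (fun y => (ν.rnDeriv (μ + ν) y).toReal) (μ + ν) :=
      Measure.integrable_toReal_rnDeriv
    have hint := (hi.const_mul (1 / (2 * t))).add ((hia.add hib).const_mul t)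
    have h2 := integral_toReal_rnDeriv_add μ ν
    rw [measureReal_sub_eq_setIntegral]
    refine (integral_mono (hia.sub hib).integrableOn hint.integrableOn fun y =>
      sub_le_sq_sub_sqrt ENNReal.toReal_nonneg ENNReal.toReal_nonneg ht).trans ?_
    refine (setIntegral_le_integral hint (ae_of_all _ fun y => ?_)).trans_eq ?_
    · simp only [Pi.add_apply, Pi.zero_apply]
      positivity
    · rw [integral_add' (hi.const_mul _) ((hia.add hib).const_mul t), integral_const_mul,
        integral_const_mul, integral_add' hia hib, h2.1, h2.2, probReal_univ, probReal_univ,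
        hellinger_sq_eq]
      field_simp
      ring
  -- The choice `t = H` gives `3 H`; when `H = 0`, let `t` tend to zero.
  rcases (hellinger_nonneg μ ν).eq_or_lt with h | h
  · rw [← h] at key ⊢
    refine le_of_forall_pos_le_add fun ε hε => ?_
    have := key (ε / 2) (by positivity)
    norm_num at this ⊢
    linarith
  · have := key _ h
    rw [sq, mul_div_assoc, div_self h.ne'] at this
    linarith


/-! ### Nearest indices -/

theorem mem_nearest {n k : ℕ} {R : Fin n → ℝ} {i : Fin n} :
    i ∈ nearest R k ↔ ((Tuple.sort R).symm i : ℕ) < k := by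
  rw [nearest, Finset.mem_filter]
  exact and_iff_right (Finset.mem_univ i)

theorem le_of_mem_nearest {n k : ℕ} {R : Fin n → ℝ} {i j : Fin n} (hi : i ∈ nearest R k)
    (hj : j ∉ nearest R k) : R i ≤ R j := by
  rw [mem_nearest] at hi hj
  rw [not_lt] at hj
  have h := Tuple.monotone_sort R
    (show (Tuple.sort R).symm i ≤ (Tuple.sort R).symm j from Fin.le_def.2 (hi.le.trans hj))
  simpa using h

/-- Strict separation determines the set, so the tie-breaking rule plays no role. -/
theorem nearest_eq_of_forall_lt {n k : ℕ} (hk : k ≤ n) {R : Fin n → ℝ} {s : Finset (Fin n)}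
    (hs : s.card = k) (h : ∀ i ∈ s, ∀ j ∉ s, R i < R j) : nearest R k = s := by
  by_contra hne
  have hcard : (nearest R k).card = s.card := by rw [card_nearest R hk, hs]
  obtain ⟨i, hi, hi'⟩ := Finset.not_subset.1 fun hsub =>
    hne (Finset.eq_of_subset_of_card_le hsub hcard.ge)
  obtain ⟨j, hj, hj'⟩ := Finset.not_subset.1 fun hsub =>
    hne (Finset.eq_of_subset_of_card_le hsub hcard.le).symm
  exact absurd (le_of_mem_nearest hi hj') (not_le.2 (h j hj i hi'))

theorem measurableSet_sort_eq {n : ℕ} (σ : Equiv.Perm (Fin n)) :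
    MeasurableSet {R : Fin n → ℝ | Tuple.sort R = σ} := by
  have : {R : Fin n → ℝ | Tuple.sort R = σ} = {R | (∀ i j, i ≤ j → R (σ i) ≤ R (σ j)) ∧
      ∀ i j, i < j → R (σ i) = R (σ j) → σ i < σ j} := by
    ext R
    rw [Set.mem_ofPred_eq, eq_comm, Tuple.eq_sort_iff]
    rfl
  rw [this]
  refine MeasurableSet.inter ?_ ?_
  · refine measurableSet_setOfPred.2 <| Measurable.forall fun i => Measurable.forall fun j =>
      Measurable.imp measurable_const ?_
    exact measurableSet_setOfPred.1 (measurableSet_le (measurable_pi_apply _) (measurable_pi_apply _))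
  · refine measurableSet_setOfPred.2 <| Measurable.forall fun i => Measurable.forall fun j =>
      Measurable.imp measurable_const (Measurable.imp ?_ measurable_const)
    exact measurableSet_setOfPred.1 (measurableSet_eq_fun (measurable_pi_apply _) (measurable_pi_apply _))

theorem measurableSet_nearest_eq {n : ℕ} (k : ℕ) (s : Finset (Fin n)) :
    MeasurableSet {R : Fin n → ℝ | nearest R k = s} := by
  have : {R : Fin n → ℝ | nearest R k = s}
      = ⋃ σ ∈ {σ : Equiv.Perm (Fin n) | (Finset.univ.filter fun i => (σ.symm i : ℕ) < k) = s},
        {R : Fin n → ℝ | Tuple.sort R = σ} := by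
    ext R
    simp only [Set.mem_iUnion, Set.mem_ofPred_eq, exists_prop, exists_eq_right']
    rfl
  rw [this]
  exact MeasurableSet.biUnion (Set.to_countable _) fun σ _ => measurableSet_sort_eq σ

variable {d m : ℕ}

local notation "E" => EuclideanSpace ℝ (Fin d)
local notation "F" => EuclideanSpace ℝ (Fin m)

theorem inducedOrderStats_of_nearest_eq (x₀ : E) {n k : ℕ} (hk : k ≤ n) (z : Fin n → E × F)
    {s : Finset (Fin n)} (hs : s.card = k) (h : nearest (fun i => ‖(z i).1 - x₀‖) k = s) :
    inducedOrderStats x₀ hk z = fun j => (z (s.orderEmbOfFin hs j)).2 := by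
  subst h
  rfl

theorem measurableSet_nearest_dist_eq (x₀ : E) {n : ℕ} (k : ℕ) (s : Finset (Fin n)) :
    MeasurableSet {z : Fin n → E × F | nearest (fun i => ‖(z i).1 - x₀‖) k = s} :=
  (measurableSet_nearest_eq k s).preimage
    (by fun_prop : Measurable fun (z : Fin n → E × F) (i : Fin n) => ‖(z i).1 - x₀‖)

theorem preimage_inducedOrderStats (x₀ : E) {n k : ℕ} (hk : k ≤ n) (B : Set (Fin k → F)) :
    inducedOrderStats x₀ hk ⁻¹' B = ⋃ s : {s : Finset (Fin n) // s.card = k},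
      {z : Fin n → E × F | nearest (fun i => ‖(z i).1 - x₀‖) k = s} ∩
        {z | (fun j => (z (s.1.orderEmbOfFin s.2 j)).2) ∈ B} := by
  ext z
  simp only [Set.mem_preimage, Set.mem_iUnion, Set.mem_inter_iff, Set.mem_ofPred_eq]
  constructor
  · exact fun h => ⟨⟨_, card_nearest _ hk⟩, rfl, h⟩
  · rintro ⟨s, h1, h2⟩
    rwa [inducedOrderStats_of_nearest_eq x₀ hk z s.2 h1]

theorem measurable_selectSnd {n k : ℕ} (e : Fin k → Fin n) :
    Measurable fun (z : Fin n → E × F) (j : Fin k) => (z (e j)).2 := by fun_prop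

theorem measurable_inducedOrderStats (x₀ : E) {n k : ℕ} (hk : k ≤ n) :
    Measurable (inducedOrderStats (m := m) x₀ hk) := by
  intro B hB
  rw [preimage_inducedOrderStats]
  exact MeasurableSet.iUnion fun s => (measurableSet_nearest_dist_eq x₀ k _).inter
    (measurable_selectSnd _ hB)

instance isProbabilityMeasure_lawSn (Q : Measure (E × F)) [IsProbabilityMeasure Q] (x₀ : E)
    {n k : ℕ} (hk : k ≤ n) : IsProbabilityMeasure (lawSn Q x₀ hk) :=
  Measure.isProbabilityMeasure_map (measurable_inducedOrderStats x₀ hk).aemeasurable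

instance isProbabilityMeasure_lawS (P : Measure F) [IsProbabilityMeasure P] (k : ℕ) :
    IsProbabilityMeasure (lawS P k) := by
  unfold lawS
  infer_instance

theorem lawSn_apply_eq_sum (Q : Measure (E × F)) [IsProbabilityMeasure Q] (x₀ : E)
    {n k : ℕ} (hk : k ≤ n) {B : Set (Fin k → F)} (hB : MeasurableSet B) :
    lawSn Q x₀ hk B = ∑ s : {s : Finset (Fin n) // s.card = k},
      Measure.pi (fun _ : Fin n => Q)
        ({z : Fin n → E × F | nearest (fun i => ‖(z i).1 - x₀‖) k = s} ∩
          {z | (fun j => (z (s.1.orderEmbOfFin s.2 j)).2) ∈ B}) := by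
  rw [lawSn, Measure.map_apply (measurable_inducedOrderStats x₀ hk) hB,
    preimage_inducedOrderStats, measure_iUnion, tsum_fintype]
  · intro s t hst
    refine Set.disjoint_left.2 fun z hz hz' => hst (Subtype.ext ?_)
    exact hz.1.symm.trans hz'.1
  · exact fun s => (measurableSet_nearest_dist_eq x₀ k _).inter (measurable_selectSnd _ hB)

/-! ### Absence of ties -/

/-- Spheres are Lebesgue null. Positive dimension matters: in dimension zero the sphere of radius
`0` is the whole space. -/
theorem sphere_null (hd : 0 < d) {Q : Measure (E × F)} {ν : Measure F} [SigmaFinite ν]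
    {f : E → F → ℝ} (hf : IsJointDensity Q ν f) (x₀ : E) (r : ℝ) :
    Q {z | ‖z.1 - x₀‖ = r} = 0 := by
  rw [hf.eq_withDensity]
  refine withDensity_absolutelyContinuous _ _ ?_
  have : {z : E × F | ‖z.1 - x₀‖ = r} = Metric.sphere x₀ r ×ˢ Set.univ := by
    ext z
    simp
  have : Nonempty (Fin d) := ⟨⟨0, hd⟩⟩
  have : Nontrivial E := inferInstance
  simp_all [Measure.addHaar_sphere]

theorem ties_null (hd : 0 < d) {Q : Measure (E × F)} [IsProbabilityMeasure Q] {ν : Measure F}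
    [SigmaFinite ν] {f : E → F → ℝ} (hf : IsJointDensity Q ν f) (x₀ : E) (k l : ℕ) :
    ∀ᵐ w ∂(Measure.pi fun _ : Fin k => Q).prod (Measure.pi fun _ : Fin l => Q),
      ∀ i j, ‖(w.1 i).1 - x₀‖ ≠ ‖(w.2 j).1 - x₀‖ := by
  rw [ae_all_iff]
  intro i
  rw [ae_all_iff]
  intro j
  have hms : MeasurableSet {w : (Fin k → E × F) × (Fin l → E × F) |
      ‖(w.1 i).1 - x₀‖ = ‖(w.2 j).1 - x₀‖} := measurableSet_eq_fun (by fun_prop) (by fun_prop)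
  rw [ae_iff]
  simp only [not_not]
  rw [Measure.prod_apply_symm hms]
  refine (lintegral_congr fun w => ?_).trans lintegral_zero
  exact (Measure.quasiMeasurePreserving_eval (fun _ : Fin k => Q) i).preimage_null
    (sphere_null hd hf x₀ ‖(w j).1 - x₀‖)

/-! ### Splitting the sample -/

theorem measurePreserving_split {α : Type*} [MeasurableSpace α] (Q : Measure α)
    [IsProbabilityMeasure Q] {n k l : ℕ} (e : Fin k ⊕ Fin l ≃ Fin n) :
    MeasurePreserving (fun z : Fin n → α => ((fun i => z (e (Sum.inl i)) : Fin k → α),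
      (fun j => z (e (Sum.inr j)) : Fin l → α))) (Measure.pi fun _ => Q)
      ((Measure.pi fun _ => Q).prod (Measure.pi fun _ => Q)) :=
  (measurePreserving_sumPiEquivProdPi (fun _ : Fin k ⊕ Fin l => Q)).comp
    (measurePreserving_piCongrLeft (fun _ : Fin n => Q) e).symm

/-- Exchangeability: reindexing puts the observations of `s` first, in increasing order, and leaves
the product law unchanged, so the value does not depend on `s`. Without ties, `s` is the nearest set
exactly when its points are strictly closer than all others. -/
theorem pi_nearest_eq_inter (hd : 0 < d) {Q : Measure (E × F)} [IsProbabilityMeasure Q]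
    {ν : Measure F} [SigmaFinite ν] {f : E → F → ℝ} (hf : IsJointDensity Q ν f) (x₀ : E)
    {k l : ℕ} (s : Finset (Fin (k + l))) (hs : s.card = k) {B : Set (Fin k → F)}
    (hB : MeasurableSet B) :
    Measure.pi (fun _ : Fin (k + l) => Q)
        ({z | nearest (fun i => ‖(z i).1 - x₀‖) k = s} ∩
          {z | (fun j => (z (s.orderEmbOfFin hs j)).2) ∈ B})
      = (Measure.pi fun _ : Fin k => Q).prod (Measure.pi fun _ : Fin l => Q)
        {w | (∀ i j, ‖(w.1 i).1 - x₀‖ < ‖(w.2 j).1 - x₀‖) ∧ (fun i => (w.1 i).2) ∈ B} := by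
  have hsc : sᶜ.card = l := by
    rw [Finset.card_compl, Fintype.card_fin, hs]
    omega
  have hmp := measurePreserving_split Q (finSumEquivOfFinset hs hsc)
  have hms : MeasurableSet {w : (Fin k → E × F) × (Fin l → E × F) |
      (∀ i j, ‖(w.1 i).1 - x₀‖ < ‖(w.2 j).1 - x₀‖) ∧ (fun i => (w.1 i).2) ∈ B} := by
    refine MeasurableSet.inter ?_ (hB.preimage (f := fun w : (Fin k → E × F) × (Fin l → E × F) =>
      fun i => (w.1 i).2) (by fun_prop))
    exact measurableSet_setOfPred.2 <| Measurable.forall fun i => Measurable.forall fun j =>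
      measurableSet_setOfPred.1 (measurableSet_lt (by fun_prop) (by fun_prop))
  rw [← hmp.measure_preimage hms.nullMeasurableSet]
  refine measure_congr ?_
  filter_upwards [hmp.quasiMeasurePreserving.ae (ties_null hd hf x₀ k l)] with z hz
  refine propext (and_congr_left fun _ => ⟨fun h => ?_, fun h => ?_⟩)
  · change nearest _ k = s at h
    intro i j
    refine lt_of_le_of_ne (le_of_mem_nearest (R := fun i => ‖(z i).1 - x₀‖) (k := k) ?_ ?_) (hz i j)
    · rw [h]
      exact s.orderEmbOfFin_mem hs i
    · rw [h]
      exact Finset.mem_compl.1 (sᶜ.orderEmbOfFin_mem hsc j)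
  · refine nearest_eq_of_forall_lt (Nat.le_add_right k l) hs fun i hi j hj => ?_
    obtain ⟨i, rfl⟩ : i ∈ Set.range (s.orderEmbOfFin hs) := by
      rwa [Finset.range_orderEmbOfFin]
    obtain ⟨j, rfl⟩ : j ∈ Set.range (sᶜ.orderEmbOfFin hsc) := by
      rw [Finset.range_orderEmbOfFin]
      exact Finset.mem_coe.2 (Finset.mem_compl.2 hj)
    exact h i j

/-! ### The mixture representation -/

/-- The smallest distance to `x₀` in a nonempty sample. -/
def minDist (x₀ : E) {l : ℕ} (w : Fin (l + 1) → E × F) : ℝ :=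
  Finset.univ.inf' Finset.univ_nonempty fun j => ‖(w j).1 - x₀‖

theorem lt_minDist_iff (x₀ : E) {l : ℕ} (w : Fin (l + 1) → E × F) (r : ℝ) :
    r < minDist x₀ w ↔ ∀ j, r < ‖(w j).1 - x₀‖ := by
  simp [minDist]

theorem measurable_minDist (x₀ : E) {l : ℕ} :
    Measurable (minDist x₀ : (Fin (l + 1) → E × F) → ℝ) := by
  refine measurable_of_Ioi fun a => ?_
  have : minDist x₀ ⁻¹' Set.Ioi a = ⋂ j : Fin (l + 1), {w : Fin (l + 1) → E × F |
      a < ‖(w j).1 - x₀‖} := by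
    ext w
    simp [lt_minDist_iff]
  rw [this]
  exact MeasurableSet.iInter fun j => measurableSet_lt measurable_const (by fun_prop)

/-- The probability `Q(X ∈ B_r)`. -/
def ballMass (Q : Measure (E × F)) (x₀ : E) (r : ℝ) : ℝ≥0∞ :=
  Q (Prod.fst ⁻¹' Metric.ball x₀ r)

theorem ballMass_mono (Q : Measure (E × F)) (x₀ : E) : Monotone (ballMass Q x₀) :=
  fun _ _ h => measure_mono (Set.preimage_mono (Metric.ball_subset_ball h))

theorem measurable_ballMass (Q : Measure (E × F)) (x₀ : E) : Measurable (ballMass Q x₀) :=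
  (ballMass_mono Q x₀).measurable

theorem measurableSet_fst_ball (x₀ : E) (r : ℝ) :
    MeasurableSet (Prod.fst ⁻¹' Metric.ball x₀ r : Set (E × F)) :=
  measurable_fst Metric.isOpen_ball.measurableSet

instance isZeroOrProbabilityMeasure_localLaw (Q : Measure (E × F)) [IsProbabilityMeasure Q]
    (x₀ : E) (r : ℝ) : IsZeroOrProbabilityMeasure (localLaw Q x₀ r) := by
  unfold localLaw
  by_cases h : ballMass Q x₀ r = 0
  · rw [cond_eq_zero_of_meas_eq_zero h, Measure.map_zero]
    infer_instance
  · have := cond_isProbabilityMeasure (μ := Q) h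
    have := Measure.isProbabilityMeasure_map
      (μ := Q[|Prod.fst ⁻¹' Metric.ball x₀ r]) measurable_snd.aemeasurable
    infer_instance

theorem isProbabilityMeasure_localLaw (Q : Measure (E × F)) [IsProbabilityMeasure Q]
    (x₀ : E) (r : ℝ) (h : ballMass Q x₀ r ≠ 0) : IsProbabilityMeasure (localLaw Q x₀ r) := by
  have := cond_isProbabilityMeasure (μ := Q) h
  exact Measure.isProbabilityMeasure_map measurable_snd.aemeasurable

theorem map_snd_restrict_ball (Q : Measure (E × F)) [IsProbabilityMeasure Q] (x₀ : E) (r : ℝ) :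
    (Q.restrict (Prod.fst ⁻¹' Metric.ball x₀ r)).map Prod.snd
      = ballMass Q x₀ r • localLaw Q x₀ r := by
  unfold localLaw
  by_cases h : ballMass Q x₀ r = 0
  · rw [h, zero_smul, Measure.restrict_eq_zero.2 h, Measure.map_zero]
  · rw [ProbabilityTheory.cond, Measure.map_smul, smul_smul]
    change _ = (ballMass Q x₀ r * (ballMass Q x₀ r)⁻¹) • _
    rw [ENNReal.mul_inv_cancel h (measure_ne_top _ _), one_smul]

theorem pi_smul_measure {α : Type*} [MeasurableSpace α] (μ μ' : Measure α) [SigmaFinite μ]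
    [SigmaFinite μ'] {c : ℝ≥0∞} (h : μ' = c • μ) (k : ℕ) :
    Measure.pi (fun _ : Fin k => μ') = c ^ k • Measure.pi fun _ : Fin k => μ := by
  refine Measure.pi_eq fun s _ => ?_
  simp [h, Measure.pi_pi, Finset.prod_mul_distrib]

/-- Restricting a product measure to a box restricts each factor. Each restricted factor projects to
the ball mass times the local law, also when that mass is zero. -/
theorem pi_forall_mem_ball_inter (Q : Measure (E × F)) [IsProbabilityMeasure Q] (x₀ : E) (r : ℝ)
    (k : ℕ) {B : Set (Fin k → F)} (hB : MeasurableSet B) :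
    Measure.pi (fun _ : Fin k => Q) {u | (∀ i, ‖(u i).1 - x₀‖ < r) ∧ (fun i => (u i).2) ∈ B}
      = ballMass Q x₀ r ^ k * lawS (localLaw Q x₀ r) k B := by
  set A : Set (E × F) := Prod.fst ⁻¹' Metric.ball x₀ r
  have hmeas : Measurable fun (u : Fin k → E × F) i => (u i).2 := by fun_prop
  have hset : {u : Fin k → E × F | (∀ i, ‖(u i).1 - x₀‖ < r) ∧ (fun i => (u i).2) ∈ B}
      = (fun u i => (u i).2) ⁻¹' B ∩ Set.pi Set.univ fun _ => A := by
    ext u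
    simp [A, dist_eq_norm, and_comm]
  rw [hset, ← Measure.restrict_apply (hmeas hB), Measure.restrict_pi_pi,
    ← Measure.map_apply hmeas hB]
  have hfin : IsFiniteMeasure ((Q.restrict A).map Prod.snd) := inferInstance
  rw [Measure.pi_map_pi (μ := fun _ : Fin k => Q.restrict A) (f := fun _ => Prod.snd)
    (fun _ => measurable_snd.aemeasurable), pi_smul_measure _ _ (map_snd_restrict_ball Q x₀ r) k]
  rfl

/-- `S_n` is a mixture of i.i.d. samples from the local laws `P_r`. -/
theorem lawSn_apply (hd : 0 < d) {Q : Measure (E × F)} [IsProbabilityMeasure Q] {ν : Measure F}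
    [SigmaFinite ν] {f : E → F → ℝ} (hf : IsJointDensity Q ν f) (x₀ : E) (k l : ℕ)
    (hk : k ≤ k + (l + 1)) {B : Set (Fin k → F)} (hB : MeasurableSet B) :
    lawSn Q x₀ hk B = ∫⁻ w, (k + (l + 1)).choose k * ballMass Q x₀ (minDist x₀ w) ^ k
      * lawS (localLaw Q x₀ (minDist x₀ w)) k B ∂Measure.pi fun _ : Fin (l + 1) => Q := by
  rw [lawSn_apply_eq_sum Q x₀ hk hB]
  simp_rw [fun s : {s : Finset (Fin (k + (l + 1))) // s.card = k} =>
    pi_nearest_eq_inter hd hf x₀ s.1 s.2 hB]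
  have hms : MeasurableSet {w : (Fin k → E × F) × (Fin (l + 1) → E × F) |
      (∀ i j, ‖(w.1 i).1 - x₀‖ < ‖(w.2 j).1 - x₀‖) ∧ (fun i => (w.1 i).2) ∈ B} := by
    refine MeasurableSet.inter ?_ (hB.preimage
      (f := fun w : (Fin k → E × F) × (Fin (l + 1) → E × F) => fun i => (w.1 i).2) (by fun_prop))
    exact measurableSet_setOfPred.2 <| Measurable.forall fun i => Measurable.forall fun j =>
      measurableSet_setOfPred.1 (measurableSet_lt (by fun_prop) (by fun_prop))
  -- All subsets contribute equally, whence the binomial coefficient; then integrate over the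
  -- farther sample last.
  rw [Finset.sum_const, Finset.card_univ, Fintype.card_finset_len, Fintype.card_fin, nsmul_eq_mul,
    Measure.prod_apply_symm hms, ← lintegral_const_mul _ (measurable_measure_prodMk_right hms)]
  refine lintegral_congr fun w => ?_
  rw [mul_assoc, ← pi_forall_mem_ball_inter Q x₀ _ k hB]
  congr 2
  ext u
  simp [lt_minDist_iff]

/-! ### Densities -/

/-- The `ν`-density of the local law `P_r`. -/
def localDensity (Q : Measure (E × F)) (f : E → F → ℝ) (x₀ : E) (r : ℝ) (y : F) : ℝ≥0∞ :=
  (ballMass Q x₀ r)⁻¹ * ∫⁻ x in Metric.ball x₀ r, ENNReal.ofReal (f x y)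

theorem measurable_localDensity (Q : Measure (E × F)) {f : E → F → ℝ}
    (hf : Measurable (Function.uncurry f)) (x₀ : E) :
    Measurable (Function.uncurry (localDensity Q f x₀)) := by
  refine ((measurable_ballMass Q x₀).comp measurable_fst).inv.mul ?_
  -- Moving the radius from the domain of integration into an indicator makes joint measurability in
  -- `(r, y)` a consequence of Tonelli.
  have h : ∀ z : ℝ × F, ∫⁻ x in Metric.ball x₀ z.1, ENNReal.ofReal (f x z.2)
      = ∫⁻ x, {p : (ℝ × F) × E | dist p.2 x₀ < p.1.1}.indicator
        (fun p => ENNReal.ofReal (f p.2 p.1.2)) (z, x) := by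
    intro z
    rw [← lintegral_indicator Metric.isOpen_ball.measurableSet]
    rfl
  simp_rw [h]
  refine Measurable.lintegral_prod_right' (f := {p : (ℝ × F) × E | dist p.2 x₀ < p.1.1}.indicator
        (fun p => ENNReal.ofReal (f p.2 p.1.2))) (Measurable.indicator ?_ ?_)
  · exact (hf.comp (f := fun p : (ℝ × F) × E => (p.2, p.1.2)) (by fun_prop)).ennreal_ofReal
  · exact measurableSet_lt (by fun_prop) (by fun_prop)

theorem measurable_prod_minDist {g : ℝ → F → ℝ≥0∞} (hg : Measurable (Function.uncurry g)) (x₀ : E)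
    (k l : ℕ) : Measurable fun z : (Fin (l + 1) → E × F) × (Fin k → F) =>
      ∏ i, g (minDist x₀ z.1) (z.2 i) := by
  refine Finset.measurable_fun_prod _ fun i _ => ?_
  have h : Measurable fun z : (Fin (l + 1) → E × F) × (Fin k → F) => (minDist x₀ z.1, z.2 i) :=
    ((measurable_minDist x₀).comp measurable_fst).prodMk
      ((measurable_pi_apply i).comp measurable_snd)
  exact hg.comp h

theorem localLaw_eq_withDensity {Q : Measure (E × F)} {ν : Measure F}
    [SigmaFinite ν] {f : E → F → ℝ} (hf : IsJointDensity Q ν f) (x₀ : E) (r : ℝ) :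
    localLaw Q x₀ r = ν.withDensity (localDensity Q f x₀ r) := by
  have hm : Measurable fun z : E × F => ENNReal.ofReal (f z.1 z.2) := hf.measurable.ennreal_ofReal
  ext B hB
  rw [localLaw, Measure.map_apply measurable_snd hB,
    ProbabilityTheory.cond_apply (measurableSet_fst_ball x₀ r), withDensity_apply _ hB]
  unfold localDensity
  rw [lintegral_const_mul _ (Measurable.lintegral_prod_right'
    (f := fun z : F × E => ENNReal.ofReal (f z.2 z.1)) (hm.comp measurable_swap))]
  change (ballMass Q x₀ r)⁻¹ * _ = _
  congr 1
  have : Prod.fst ⁻¹' Metric.ball x₀ r ∩ Prod.snd ⁻¹' B = Metric.ball x₀ r ×ˢ B := by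
    ext z
    simp
  rw [this]
  conv_lhs => rw [hf.eq_withDensity]
  rw [withDensity_apply _ (Metric.isOpen_ball.measurableSet.prod hB), ← Measure.prod_restrict,
    lintegral_prod_symm _ hm.aemeasurable]

theorem isProbabilityMeasure_condLaw {ν : Measure F} {f : E → F → ℝ} (hf : ∀ x y, 0 ≤ f x y)
    {x₀ : E} (hg : 0 < marginalDensity ν f x₀) : IsProbabilityMeasure (condLaw ν f x₀) := by
  -- A non-integrable function has integral `0` by convention, contrary to positivity.
  have hi : Integrable (f x₀) ν := by
    by_contra h
    exact hg.ne' (integral_undef h)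
  constructor
  rw [condLaw, withDensity_apply _ MeasurableSet.univ, Measure.restrict_univ,
    ← ofReal_integral_eq_lintegral_ofReal (hi.div_const _)
      (ae_of_all _ fun y => div_nonneg (hf _ _) hg.le), integral_div]
  change ENNReal.ofReal (marginalDensity ν f x₀ / marginalDensity ν f x₀) = 1
  rw [div_self hg.ne', ENNReal.ofReal_one]

/-! ### The mixing law -/

/-- The mixing law of the representation of `S_n` as a mixture of samples from local laws. -/
def mixingLaw (Q : Measure (E × F)) (x₀ : E) (k l : ℕ) : Measure (Fin (l + 1) → E × F) :=
  (Measure.pi fun _ : Fin (l + 1) => Q).withDensity fun w =>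
    (k + (l + 1)).choose k * ballMass Q x₀ (minDist x₀ w) ^ k

theorem measurable_ballMass_minDist (Q : Measure (E × F)) (x₀ : E) (l : ℕ) :
    Measurable fun w : Fin (l + 1) → E × F => ballMass Q x₀ (minDist x₀ w) :=
  (measurable_ballMass Q x₀).comp (measurable_minDist x₀)

/-- The mixing density contains the factor `G^k` with `k ≥ 1`, so radii with null balls are never
charged and the local laws met are probabilities. -/
theorem ae_ballMass_ne_zero (Q : Measure (E × F)) (x₀ : E) {k : ℕ} (hk : k ≠ 0) (l : ℕ) :
    ∀ᵐ w ∂mixingLaw Q x₀ k l, ballMass Q x₀ (minDist x₀ w) ≠ 0 := by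
  have h := measurable_ballMass_minDist Q x₀ l
  rw [mixingLaw, ae_withDensity_iff (by fun_prop)]
  refine ae_of_all _ fun w hw h0 => hw ?_
  rw [h0, zero_pow hk, mul_zero]

variable {Q : Measure (EuclideanSpace ℝ (Fin d) × EuclideanSpace ℝ (Fin m))}
  [IsProbabilityMeasure Q] {ν : Measure (EuclideanSpace ℝ (Fin m))} [SigmaFinite ν]
  {f : EuclideanSpace ℝ (Fin d) → EuclideanSpace ℝ (Fin m) → ℝ}

theorem lintegral_choose_mul_ballMass_pow (hd : 0 < d) (hf : IsJointDensity Q ν f) (x₀ : E)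
    (k l : ℕ) : ∫⁻ w, (k + (l + 1)).choose k * ballMass Q x₀ (minDist x₀ w) ^ k
      ∂(Measure.pi fun _ : Fin (l + 1) => Q) = 1 := by
  have h := lawSn_apply hd hf x₀ k l (Nat.le_add_right _ _) MeasurableSet.univ
  rw [measure_univ] at h
  rw [h]
  refine lintegral_congr fun w => ?_
  by_cases h0 : ballMass Q x₀ (minDist x₀ w) = 0
  -- For `k = 0` the weight need not vanish, but the empty product has mass one whatever the local
  -- law is.
  · rcases eq_or_ne k 0 with rfl | hk
    · have : lawS (localLaw Q x₀ (minDist x₀ w)) 0 Set.univ = 1 := by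
        simp [lawS]
      rw [this, mul_one]
    · rw [h0, zero_pow hk, mul_zero, zero_mul]
  · have := isProbabilityMeasure_localLaw Q x₀ _ h0
    rw [measure_univ, mul_one]

theorem isProbabilityMeasure_mixingLaw (hd : 0 < d) (hf : IsJointDensity Q ν f) (x₀ : E)
    (k l : ℕ) : IsProbabilityMeasure (mixingLaw Q x₀ k l) := by
  constructor
  rw [mixingLaw, withDensity_apply _ MeasurableSet.univ, Measure.restrict_univ,
    lintegral_choose_mul_ballMass_pow hd hf]

theorem lintegral_mixingLaw (x₀ : E) (k l : ℕ) (φ : (Fin (l + 1) → E × F) → ℝ≥0∞) :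
    ∫⁻ w, φ w ∂mixingLaw Q x₀ k l = ∫⁻ w, (k + (l + 1)).choose k *
      ballMass Q x₀ (minDist x₀ w) ^ k * φ w ∂(Measure.pi fun _ : Fin (l + 1) => Q) := by
  have h := measurable_ballMass_minDist Q x₀ l
  rw [mixingLaw, lintegral_withDensity_eq_lintegral_mul_non_measurable _ (by fun_prop)
    (ae_of_all _ fun w => ?_)]
  · rfl
  · exact ENNReal.mul_lt_top (ENNReal.natCast_lt_top _)
      (ENNReal.pow_lt_top (measure_lt_top _ _))

theorem lawSn_apply_mixingLaw (hd : 0 < d) (hf : IsJointDensity Q ν f) (x₀ : E) (k l : ℕ)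
    (hk : k ≤ k + (l + 1)) {B : Set (Fin k → F)} (hB : MeasurableSet B) :
    lawSn Q x₀ hk B = ∫⁻ w, lawS (localLaw Q x₀ (minDist x₀ w)) k B ∂mixingLaw Q x₀ k l := by
  rw [lawSn_apply hd hf x₀ k l hk hB, lintegral_mixingLaw]

/-! ### Moments of the ball mass -/

theorem choose_mul_pow_le (n k q : ℕ) :
    n.choose k * n ^ q ≤ (n + q).choose (k + q) * (k + q) ^ q := by
  induction q with
  | zero => simp
  | succ q ih =>
    calc n.choose k * n ^ (q + 1) = n.choose k * n ^ q * n := by ring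
      _ ≤ (n + q).choose (k + q) * (k + q) ^ q * (n + q + 1) :=
        Nat.mul_le_mul ih (by omega)
      _ = ((n + q + 1) * (n + q).choose (k + q)) * (k + q) ^ q := by ring
      _ = (n + q + 1).choose (k + q + 1) * (k + q + 1) * (k + q) ^ q := by
        rw [Nat.add_one_mul_choose_eq]
      _ ≤ (n + q + 1).choose (k + q + 1) * (k + q + 1) * (k + q + 1) ^ q :=
        Nat.mul_le_mul_left _ (Nat.pow_le_pow_left (by omega) _)
      _ = _ := by rw [← add_assoc, ← add_assoc]; ring

/-- Moments of integer order of the mass of the ball up to the `(k+1)`-st neighbour. -/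
theorem lintegral_ballMass_pow_le (hd : 0 < d) (hf : IsJointDensity Q ν f) (x₀ : E)
    {k : ℕ} (hk : 1 ≤ k) (l q : ℕ) :
    ∫⁻ w, ballMass Q x₀ (minDist x₀ w) ^ q ∂mixingLaw Q x₀ k l
      ≤ (q + 1) ^ q * ((k : ℝ≥0∞) / (k + (l + 1) : ℕ)) ^ q := by
  have hm := measurable_ballMass_minDist Q x₀ l
  set n := k + (l + 1) with hn
  have hn0 : (n : ℝ≥0∞) ≠ 0 := by simp [hn]
  -- Total mass one for `k + q` nearest points among `n + q`, with the same farther sample,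
  -- evaluates the integral of `G^(k+q)` exactly.
  have h1 := lintegral_choose_mul_ballMass_pow hd hf x₀ (k + q) l
  rw [lintegral_const_mul _ (by fun_prop)] at h1
  rw [lintegral_mixingLaw]
  simp_rw [mul_assoc, ← pow_add]
  rw [lintegral_const_mul _ (by fun_prop)]
  set I := ∫⁻ w, ballMass Q x₀ (minDist x₀ w) ^ (k + q) ∂(Measure.pi fun _ : Fin (l + 1) => Q)
  rw [show k + q + (l + 1) = n + q by omega] at h1
  have h2 : (n.choose k : ℝ≥0∞) * n ^ q ≤ (n + q).choose (k + q) * ((q + 1) * k) ^ q := by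
    have : n.choose k * n ^ q ≤ (n + q).choose (k + q) * ((q + 1) * k) ^ q :=
      (choose_mul_pow_le n k q).trans
        (Nat.mul_le_mul_left _ (Nat.pow_le_pow_left (by nlinarith) _))
    exact_mod_cast this
  rw [← mul_pow, ← mul_div_assoc, ENNReal.div_eq_inv_mul, mul_pow, ← ENNReal.inv_pow,
    ← ENNReal.div_eq_inv_mul, ENNReal.le_div_iff_mul_le (Or.inl (pow_ne_zero _ hn0))
      (Or.inl (ENNReal.pow_ne_top (ENNReal.natCast_ne_top _)))]
  calc (n.choose k : ℝ≥0∞) * I * n ^ q = (n.choose k * n ^ q) * I := by ring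
    _ ≤ ((n + q).choose (k + q) * ((q + 1) * k) ^ q) * I := by gcongr
    _ = ((n + q).choose (k + q) * I) * ((q + 1) * k) ^ q := by ring
    _ = _ := by rw [h1, one_mul]

/-- Below `t` the first term suffices; above `t`, the exponent `p - q` is nonpositive, so `x^(p-q) ≤
t^(p-q)`. With `t = k/n` this reduces real moments to integer ones. -/
theorem rpow_le_add_mul_pow {x t : ℝ≥0∞} (ht0 : t ≠ 0) (ht : t ≠ ∞) {p : ℝ} (hp : 0 ≤ p) {q : ℕ}
    (hpq : p ≤ q) : x ^ p ≤ t ^ p + t ^ (p - q) * x ^ q := by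
  rcases le_total x t with h | h
  · exact (ENNReal.rpow_le_rpow h hp).trans le_self_add
  · refine le_add_left ?_
    rcases eq_or_ne x ∞ with rfl | hx
    · rcases eq_or_ne q 0 with rfl | hq
      · have : p = 0 := le_antisymm (by simpa using hpq) hp
        simp [this]
      · rw [ENNReal.top_pow hq, ENNReal.mul_top]
        · exact le_top
        · simp [ENNReal.rpow_eq_zero_iff, ht0, ht]
    · have hx0 : x ≠ 0 := fun h0 => ht0 (le_zero_iff.1 (h0 ▸ h))
      calc x ^ p = x ^ (p - q) * x ^ q := by
            rw [← ENNReal.rpow_natCast, ← ENNReal.rpow_add _ _ hx0 hx, sub_add_cancel]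
        _ ≤ _ := by
            gcongr ?_ * _
            rw [← neg_sub, ENNReal.rpow_neg, ENNReal.rpow_neg]
            exact ENNReal.inv_le_inv.2 (ENNReal.rpow_le_rpow h (by linarith))

/-- Moments of real order of the mass of the ball up to the `(k+1)`-st neighbour. -/
theorem exists_lintegral_ballMass_rpow_le (hd : 0 < d) (hf : IsJointDensity Q ν f) (x₀ : E)
    {p : ℝ} (hp : 0 ≤ p) : ∃ C : ℝ, 0 ≤ C ∧ ∀ k l : ℕ, 1 ≤ k →
      ∫⁻ w, ballMass Q x₀ (minDist x₀ w) ^ p ∂mixingLaw Q x₀ k l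
        ≤ ENNReal.ofReal (C * ((k : ℝ) / (k + (l + 1) : ℕ)) ^ p) := by
  obtain ⟨q, hq⟩ := exists_nat_ge p
  refine ⟨1 + (q + 1) ^ q, by positivity, fun k l hk => ?_⟩
  have := isProbabilityMeasure_mixingLaw hd hf x₀ k l
  have hm := measurable_ballMass_minDist Q x₀ l
  set n := k + (l + 1) with hn
  have hn0 : (0 : ℝ) < n := by simp only [hn]; positivity
  have hk0 : (0 : ℝ) < k := by exact_mod_cast hk
  have hkn : (k : ℝ≥0∞) / n = ENNReal.ofReal ((k : ℝ) / n) := by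
    rw [ENNReal.ofReal_div_of_pos hn0, ENNReal.ofReal_natCast, ENNReal.ofReal_natCast]
  set t := ENNReal.ofReal ((k : ℝ) / n) with ht
  have ht0 : t ≠ 0 := by simp only [ht, ne_eq, ENNReal.ofReal_eq_zero, not_le]; positivity
  have htt : t ≠ ∞ := ENNReal.ofReal_ne_top
  calc ∫⁻ w, ballMass Q x₀ (minDist x₀ w) ^ p ∂mixingLaw Q x₀ k l
      ≤ ∫⁻ w, (t ^ p + t ^ (p - q) * ballMass Q x₀ (minDist x₀ w) ^ q) ∂mixingLaw Q x₀ k l :=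
        lintegral_mono fun w => rpow_le_add_mul_pow ht0 htt hp hq
    _ = t ^ p + t ^ (p - q) * ∫⁻ w, ballMass Q x₀ (minDist x₀ w) ^ q ∂mixingLaw Q x₀ k l := by
        rw [lintegral_add_left measurable_const, lintegral_const_mul _ (by fun_prop)]
        simp
    _ ≤ t ^ p + t ^ (p - q) * ((q + 1) ^ q * t ^ q) := by
        gcongr
        rw [← hkn]
        exact lintegral_ballMass_pow_le hd hf x₀ hk l q
    _ = t ^ p + (q + 1) ^ q * (t ^ (p - q) * t ^ (q : ℝ)) := by
        rw [ENNReal.rpow_natCast]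
        ring
    _ = (1 + (q + 1) ^ q) * t ^ p := by
        rw [← ENNReal.rpow_add _ _ ht0 htt, sub_add_cancel]
        ring
    _ = _ := by
        rw [ENNReal.ofReal_mul (by positivity), ht,
          ENNReal.ofReal_rpow_of_nonneg (by positivity) hp]
        congr 1
        have : ((1 + (q + 1) ^ q : ℕ) : ℝ≥0∞) = ENNReal.ofReal ((1 + (q + 1) ^ q : ℕ) : ℝ) :=
          (ENNReal.ofReal_natCast _).symm
        push_cast at this
        exact this

/-! ### Small balls -/

theorem ballMass_ne_top (Q : Measure (E × F)) [IsFiniteMeasure Q] (x₀ : E) (r : ℝ) :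
    ballMass Q x₀ r ≠ ∞ := measure_ne_top _ _

theorem exists_ballMass_ge (hf : IsJointDensity Q ν f) {𝒳 : Set E} (h𝒳 : MeasurableSet 𝒳) {x₀ : E}
    (hg : LocallyRegular 𝒳 (marginalDensity ν f) x₀) :
    ∃ c > 0, ∃ δ > 0, ∀ r : ℝ, 0 < r → r < δ → c * r ^ d ≤ (ballMass Q x₀ r).toReal := by
  obtain ⟨C, hC⟩ := hg.lipschitz
  obtain ⟨c, hc, r₀, hr₀, hvol⟩ := hg.thick
  obtain ⟨δ, hδ, hball⟩ := Metric.mem_nhdsWithin_iff.1 hC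
  have hpos := hg.pos
  set g := marginalDensity ν f
  have hm : Measurable fun z : E × F => ENNReal.ofReal (f z.1 z.2) := hf.measurable.ennreal_ofReal
  -- The last bound on the radius makes the Lipschitz error at most `g x₀ / 2`, so `g ≥ g x₀ / 2` on
  -- the part of the ball inside `𝒳`.
  refine ⟨g x₀ / 2 * c, by positivity, min (min δ r₀) (g x₀ / (2 * (|C| + 1))), by positivity,
    fun r hr hrlt => ?_⟩
  have hr1 : r < δ := hrlt.trans_le ((min_le_left _ _).trans (min_le_left _ _))
  have hr2 : r < r₀ := hrlt.trans_le ((min_le_left _ _).trans (min_le_right _ _))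
  have hr3 : r * (2 * (|C| + 1)) < g x₀ :=
    (lt_div_iff₀ (by positivity)).1 (hrlt.trans_le (min_le_right _ _))
  set A := Metric.ball x₀ r ∩ 𝒳
  have hA : MeasurableSet A := Metric.isOpen_ball.measurableSet.inter h𝒳
  have hgA : ∀ x ∈ A, g x₀ / 2 ≤ g x := by
    intro x hx
    have hx1 : ‖x - x₀‖ < r := by simpa [dist_eq_norm] using hx.1
    have h1 : |g x - g x₀| ≤ C * ‖x - x₀‖ :=
      hball ⟨Metric.ball_subset_ball hr1.le hx.1, hx.2⟩
    have h2 : C * ‖x - x₀‖ ≤ |C| * r :=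
      mul_le_mul (le_abs_self C) hx1.le (norm_nonneg _) (abs_nonneg _)
    have h3 := (abs_le.1 (h1.trans h2)).1
    nlinarith
  have hlow : ENNReal.ofReal (g x₀ / 2) * volume A ≤ ballMass Q x₀ r := by
    rw [ballMass]
    conv_rhs => rw [hf.eq_withDensity]
    rw [withDensity_apply _ (measurableSet_fst_ball x₀ r), ← Set.prod_univ,
      ← Measure.prod_restrict, Measure.restrict_univ, lintegral_prod _ hm.aemeasurable]
    calc ENNReal.ofReal (g x₀ / 2) * volume A = ∫⁻ _ in A, ENNReal.ofReal (g x₀ / 2) := by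
          rw [setLIntegral_const]
      _ ≤ ∫⁻ x in A, ∫⁻ y, ENNReal.ofReal (f x y) ∂ν := by
          refine setLIntegral_mono' hA fun x hx => ?_
          have hi : Integrable (f x) ν := by
            by_contra h
            have h0 : g x = 0 := integral_undef h
            linarith [hgA x hx]
          rw [← ofReal_integral_eq_lintegral_ofReal hi (ae_of_all _ fun y => hf.nonneg x y)]
          exact ENNReal.ofReal_le_ofReal (hgA x hx)
      _ ≤ _ := lintegral_mono_set Set.inter_subset_left
  have h := ENNReal.toReal_mono (measure_ne_top _ _) hlow
  rw [ENNReal.toReal_mul, ENNReal.toReal_ofReal (by positivity)] at h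
  refine le_trans ?_ h
  rw [mul_assoc]
  exact mul_le_mul_of_nonneg_left (hvol r hr hr2) (by positivity)

/-- A bounded quantity of order `r ^ a` at `0` is controlled by the mass of the ball. -/
theorem exists_le_rpow_of_isBigO (hd : 0 < d) {G D : ℝ → ℝ} (hG : Monotone G) {c δ : ℝ} (hc : 0 < c)
    (hδ : 0 < δ) (hGc : ∀ r : ℝ, 0 < r → r < δ → c * r ^ d ≤ G r) (hD0 : ∀ r, 0 ≤ D r)
    (hD1 : ∀ r, D r ≤ 1) {a : ℝ} (ha : 0 ≤ a) (hDa : D =O[𝓝[>] 0] fun r : ℝ => r ^ a) :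
    ∃ K : ℝ, 0 ≤ K ∧ ∀ r, 0 < r → D r ≤ K * G r ^ (a / d) := by
  obtain ⟨M, hM0, hM⟩ := hDa.exists_nonneg
  obtain ⟨ε, hε, hball⟩ := Metric.mem_nhdsWithin_iff.1 hM.bound
  have hd0 : (0 : ℝ) < d := by exact_mod_cast hd
  set η := min δ ε
  have hη0 : 0 < η := lt_min hδ hε
  have hpow : ∀ r : ℝ, 0 < r → r < η → c ^ (a / d) * r ^ a ≤ G r ^ (a / d) := by
    intro r hr hrη
    have h := Real.rpow_le_rpow (by positivity) (hGc r hr (hrη.trans_le (min_le_left _ _)))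
      (by positivity : 0 ≤ a / d)
    rwa [Real.mul_rpow hc.le (by positivity), ← Real.rpow_natCast, ← Real.rpow_mul hr.le,
      mul_div_cancel₀ _ hd0.ne'] at h
  have hcp : 0 < c ^ (a / d) := Real.rpow_pos_of_pos hc _
  have hηp : 0 < (η / 2) ^ a := Real.rpow_pos_of_pos (by positivity) _
  -- `M` serves radii below `η`. For larger radii `D ≤ 1`, and monotonicity compares `G r` with `G
  -- (η / 2)`.
  refine ⟨max M (1 / (η / 2) ^ a) / c ^ (a / d), by positivity, fun r hr => ?_⟩
  rw [div_mul_eq_mul_div, le_div_iff₀ hcp]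
  rcases lt_or_ge r η with hlt | hge
  · have hmem : ‖D r‖ ≤ M * ‖r ^ a‖ := by
      refine hball ⟨?_, hr⟩
      rw [Metric.mem_ball, Real.dist_eq, sub_zero, abs_of_pos hr]
      exact hlt.trans_le (min_le_right _ _)
    rw [Real.norm_of_nonneg (hD0 r), Real.norm_of_nonneg (by positivity)] at hmem
    calc D r * c ^ (a / d) ≤ M * r ^ a * c ^ (a / d) := by gcongr
      _ = M * (c ^ (a / d) * r ^ a) := by ring
      _ ≤ _ := mul_le_mul (le_max_left _ _) (hpow r hr hlt) (by positivity) (by positivity)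
  · have h1 := hpow (η / 2) (by positivity) (by linarith)
    have h0 : 0 ≤ G (η / 2) := le_trans (by positivity)
      (hGc (η / 2) (by positivity) (by have := min_le_left δ ε; linarith))
    have h2 : G (η / 2) ^ (a / d) ≤ G r ^ (a / d) :=
      Real.rpow_le_rpow h0 (hG (by linarith)) (by positivity)
    calc D r * c ^ (a / d) ≤ 1 * c ^ (a / d) := by gcongr; exact hD1 r
      _ = 1 / (η / 2) ^ a * (c ^ (a / d) * (η / 2) ^ a) := by field_simp
      _ ≤ _ := mul_le_mul (le_max_right _ _) (h1.trans h2) (by positivity) (by positivity)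

theorem exists_ofReal_le_ballMass_rpow (hd : 0 < d) (hf : IsJointDensity Q ν f) {𝒳 : Set E}
    (h𝒳 : MeasurableSet 𝒳) {x₀ : E} (hg : LocallyRegular 𝒳 (marginalDensity ν f) x₀) {D : ℝ → ℝ}
    (hD0 : ∀ r, 0 ≤ D r) (hD1 : ∀ r, D r ≤ 1) {a : ℝ} (ha : 0 ≤ a)
    (hDa : D =O[𝓝[>] 0] fun r : ℝ => r ^ a) :
    ∃ K : ℝ, 0 ≤ K ∧ ∀ r, ballMass Q x₀ r ≠ 0 →
      ENNReal.ofReal (D r) ≤ ENNReal.ofReal K * ballMass Q x₀ r ^ (a / d) := by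
  obtain ⟨c, hc, δ, hδ, h⟩ := exists_ballMass_ge hf h𝒳 hg
  obtain ⟨K, hK, hDK⟩ := exists_le_rpow_of_isBigO (G := fun r => (ballMass Q x₀ r).toReal) hd
    (fun r s hrs => ENNReal.toReal_mono (measure_ne_top _ _) (ballMass_mono Q x₀ hrs))
    hc hδ h hD0 hD1 ha hDa
  refine ⟨K, hK, fun r hr => ?_⟩
  have hr0 : 0 < r := by
    by_contra hle
    refine hr ?_
    rw [ballMass, Metric.ball_eq_empty.2 (not_lt.1 hle), Set.preimage_empty, measure_empty]
  refine (ENNReal.ofReal_le_ofReal (hDK r hr0)).trans_eq ?_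
  rw [ENNReal.ofReal_mul hK, ← ENNReal.ofReal_rpow_of_nonneg ENNReal.toReal_nonneg (by positivity),
    ENNReal.ofReal_toReal (ballMass_ne_top Q x₀ r)]

/-! ### Bounds for the law of the induced order statistics -/

/-- Average the product bound over the mixing law. The majorant `b` is there because measurability
of the distance in `r` is not established. -/
theorem tvDist_lawSn_le (hd : 0 < d) (hf : IsJointDensity Q ν f) (x₀ : E)
    (P : Measure F) [IsProbabilityMeasure P] {k : ℕ} (hk : 1 ≤ k) (l : ℕ) (hkn : k ≤ k + (l + 1)) {b : ℝ → ℝ≥0∞}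
    (hb : Measurable b) (hPb : ∀ r, ballMass Q x₀ r ≠ 0 →
      ENNReal.ofReal (tvDist (localLaw Q x₀ r) P) ≤ b r)
    {c : ℝ} (hc : 0 ≤ c) (hint : ∫⁻ w, b (minDist x₀ w) ∂mixingLaw Q x₀ k l ≤ ENNReal.ofReal c) :
    tvDist (lawSn Q x₀ hkn) (lawS P k) ≤ k * c := by
  have := isProbabilityMeasure_mixingLaw hd hf x₀ k l
  have hbm : Measurable fun w : Fin (l + 1) → E × F => b (minDist x₀ w) :=
    hb.comp (measurable_minDist x₀)
  refine tvDist_le_of_forall_sub_le _ _ fun B hB => ?_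
  have h : lawSn Q x₀ hkn B ≤ lawS P k B + k * ENNReal.ofReal c := by
    rw [lawSn_apply_mixingLaw hd hf x₀ k l hkn hB]
    calc ∫⁻ w, lawS (localLaw Q x₀ (minDist x₀ w)) k B ∂mixingLaw Q x₀ k l
        ≤ ∫⁻ w, (lawS P k B + k * b (minDist x₀ w)) ∂mixingLaw Q x₀ k l := by
          refine lintegral_mono_ae ?_
          filter_upwards [ae_ballMass_ne_zero Q x₀ (by omega : k ≠ 0) l] with w hw
          have := isProbabilityMeasure_localLaw Q x₀ _ hw
          exact pi_apply_le_add _ _ (fun B hB => (measure_le_add_tvDist _ _ hB).trans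
            (by gcongr; exact hPb _ hw)) k B hB
      _ = lawS P k B + k * ∫⁻ w, b (minDist x₀ w) ∂mixingLaw Q x₀ k l := by
          rw [lintegral_add_left measurable_const, lintegral_const_mul _ hbm]
          simp
      _ ≤ _ := by gcongr
  have h' := ENNReal.toReal_mono (by finiteness) h
  rw [ENNReal.toReal_add (by finiteness) (by finiteness), ENNReal.toReal_mul,
    ENNReal.toReal_ofReal hc, ENNReal.toReal_natCast] at h'
  simp only [measureReal_def]
  linarith

theorem lawSn_eq_withDensity (hd : 0 < d) (hf : IsJointDensity Q ν f) (x₀ : E)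
    {k : ℕ} (hk : 1 ≤ k) (l : ℕ) (hkn : k ≤ k + (l + 1)) :
    lawSn Q x₀ hkn = (Measure.pi fun _ : Fin k => ν).withDensity fun y =>
      ∫⁻ w, ∏ i, localDensity Q f x₀ (minDist x₀ w) (y i) ∂mixingLaw Q x₀ k l := by
  have := isProbabilityMeasure_mixingLaw hd hf x₀ k l
  have hmd := measurable_localDensity Q hf.measurable x₀
  have hprod := measurable_prod_minDist hmd x₀ k l
  ext B hB
  rw [lawSn_apply_mixingLaw hd hf x₀ k l hkn hB, withDensity_apply _ hB,
    lintegral_lintegral_swap (f := fun (y : Fin k → F) (w : Fin (l + 1) → E × F) =>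
      ∏ i, localDensity Q f x₀ (minDist x₀ w) (y i)) (hprod.comp measurable_swap).aemeasurable]
  refine lintegral_congr_ae ?_
  filter_upwards [ae_ballMass_ne_zero Q x₀ (by omega : k ≠ 0) l] with w hw
  have h1 := isProbabilityMeasure_localLaw Q x₀ _ hw
  rw [lawS]
  rw [localLaw_eq_withDensity hf] at h1 ⊢
  rw [pi_withDensity ν _ hmd.of_uncurry_left, withDensity_apply _ hB]

/-- The affinity of the mixture with the product target is at least the mean affinity of its
components, by concavity. Each component has affinity `(1 - H²)^k`, which Bernoulli's inequality
bounds below. -/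
theorem hellinger_lawSn_sq_le (hd : 0 < d) (hf : IsJointDensity Q ν f) {x₀ : E}
    (hg : 0 < marginalDensity ν f x₀) {k : ℕ} (hk : 1 ≤ k) (l : ℕ) (hkn : k ≤ k + (l + 1))
    {b : ℝ → ℝ≥0∞} (hb : Measurable b) (hPb : ∀ r, ballMass Q x₀ r ≠ 0 →
      ENNReal.ofReal (hellinger (localLaw Q x₀ r) (condLaw ν f x₀) ^ 2) ≤ b r)
    {c : ℝ} (hc : 0 ≤ c) (hint : ∫⁻ w, b (minDist x₀ w) ∂mixingLaw Q x₀ k l ≤ ENNReal.ofReal c) :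
    hellinger (lawSn Q x₀ hkn) (lawS (condLaw ν f x₀) k) ^ 2 ≤ k * c := by
  have := isProbabilityMeasure_mixingLaw hd hf x₀ k l
  have hbm : Measurable fun w : Fin (l + 1) → E × F => b (minDist x₀ w) :=
    hb.comp (measurable_minDist x₀)
  have hP := isProbabilityMeasure_condLaw hf.nonneg hg
  have hmd := measurable_localDensity Q hf.measurable x₀
  have hmr : ∀ r, Measurable (localDensity Q f x₀ r) := fun r =>
    hmd.of_uncurry_left
  have hprod := measurable_prod_minDist hmd x₀ k l
  set q : F → ℝ≥0∞ := fun y => ENNReal.ofReal (f x₀ y / marginalDensity ν f x₀)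
  have hqm : Measurable q := ((hf.measurable.comp (f := fun y : F => (x₀, y))
    (by fun_prop)).div_const _).ennreal_ofReal
  have hS : lawS (condLaw ν f x₀) k
      = (Measure.pi fun _ : Fin k => ν).withDensity fun y => ∏ i, q (y i) := by
    rw [lawS]
    rw [condLaw] at hP ⊢
    exact pi_withDensity ν q hqm
  have hSn := lawSn_eq_withDensity hd hf x₀ hk l hkn
  have p1 : IsProbabilityMeasure (lawSn Q x₀ hkn) := inferInstance
  have p2 : IsProbabilityMeasure (lawS (condLaw ν f x₀) k) := inferInstance
  rw [hSn, hS]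
  rw [hSn] at p1
  rw [hS] at p2
  have hone := hellinger_sq_add_affinity (Measure.pi fun _ : Fin k => ν)
    (p := fun y => ∫⁻ w, ∏ i, localDensity Q f x₀ (minDist x₀ w) (y i) ∂mixingLaw Q x₀ k l)
    (q := fun y => ∏ i, q (y i)) (hprod.comp measurable_swap).lintegral_prod_right'
    (by fun_prop)
  set A := affinity (Measure.pi fun _ : Fin k => ν)
    (fun y => ∫⁻ w, ∏ i, localDensity Q f x₀ (minDist x₀ w) (y i) ∂mixingLaw Q x₀ k l)
    (fun y => ∏ i, q (y i))
  have hAle : 1 ≤ A + k * ENNReal.ofReal c := by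
    calc (1 : ℝ≥0∞) = ∫⁻ _, 1 ∂mixingLaw Q x₀ k l := by simp
      _ ≤ ∫⁻ w, (affinity (Measure.pi fun _ : Fin k => ν)
            (fun y => ∏ i, localDensity Q f x₀ (minDist x₀ w) (y i)) (fun y => ∏ i, q (y i))
            + k * b (minDist x₀ w)) ∂mixingLaw Q x₀ k l := by
          refine lintegral_mono_ae ?_
          filter_upwards [ae_ballMass_ne_zero Q x₀ (by omega : k ≠ 0) l] with w hw
          have h1 := isProbabilityMeasure_localLaw Q x₀ _ hw
          have h2 := hPb _ hw
          rw [localLaw_eq_withDensity hf] at h1 h2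
          rw [condLaw] at hP h2
          rw [affinity_pi ν (hmr _) hqm]
          refine one_le_pow_add_mul ?_
          rw [← hellinger_sq_add_affinity ν (hmr (minDist x₀ w)) hqm, add_comm]
          gcongr
      _ = ∫⁻ w, affinity (Measure.pi fun _ : Fin k => ν)
            (fun y => ∏ i, localDensity Q f x₀ (minDist x₀ w) (y i)) (fun y => ∏ i, q (y i))
            ∂mixingLaw Q x₀ k l + k * ∫⁻ w, b (minDist x₀ w) ∂mixingLaw Q x₀ k l := by
          rw [lintegral_add_right _ (hbm.const_mul _), lintegral_const_mul _ hbm]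
      _ ≤ A + k * ENNReal.ofReal c := by
          gcongr
          exact lintegral_affinity_le _ _ hprod (by fun_prop)
  -- Finiteness allows the affinity to be cancelled between the identity `H² + A = 1` and the lower
  -- bound.
  have hAfin : A ≠ ∞ := fun h => by simp [h] at hone
  rw [← hone, add_comm] at hAle
  have h := (ENNReal.add_le_add_iff_left hAfin).1 hAle
  rw [← ENNReal.ofReal_natCast, ← ENNReal.ofReal_mul (by positivity)] at h
  exact (ENNReal.ofReal_le_ofReal_iff (by positivity)).1 h

/-! ### Rates in `k` and `n` -/

theorem exists_hellinger_lawSn_le (hd : 0 < d) (hf : IsJointDensity Q ν f) {𝒳 : Set E}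
    (h𝒳 : MeasurableSet 𝒳) {x₀ : E} (hg : LocallyRegular 𝒳 (marginalDensity ν f) x₀) {a : ℝ}
    (ha : 0 ≤ a) (hH : (fun r : ℝ => hellinger (localLaw Q x₀ r) (condLaw ν f x₀))
      =O[𝓝[>] 0] fun r : ℝ => r ^ a) :
    ∃ C : ℝ, 0 ≤ C ∧ ∀ (n k : ℕ) (_ : 1 ≤ k) (hkn : k ≤ n),
      hellinger (lawSn Q x₀ hkn) (lawS (condLaw ν f x₀) k)
        ≤ C * ((k : ℝ) ^ (1 / 2 : ℝ) * ((k : ℝ) / (n : ℝ)) ^ (a / (d : ℝ))) := by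
  have hP := isProbabilityMeasure_condLaw hf.nonneg hg.pos
  obtain ⟨K, hK, hKb⟩ := exists_ofReal_le_ballMass_rpow hd hf h𝒳 hg
    (D := fun r => hellinger (localLaw Q x₀ r) (condLaw ν f x₀))
    (fun r => hellinger_nonneg _ _) (fun r => hellinger_le_one _ _) ha hH
  have hp : 0 ≤ a / d * 2 := by positivity
  obtain ⟨C, hC, hCb⟩ := exists_lintegral_ballMass_rpow_le hd hf x₀ hp
  refine ⟨max 1 √(K ^ 2 * C), by positivity, fun n k hk hkn => ?_⟩
  have hk1 : (1 : ℝ) ≤ k := by exact_mod_cast hk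
  -- When `k = n` no farther observation exists and the mixture is unavailable. But then `k / n =
  -- 1`, and the trivial bound by `1` suffices since the constant is at least `1`.
  rcases hkn.eq_or_lt with rfl | hlt
  · rw [div_self (by positivity), Real.one_rpow, mul_one]
    refine (hellinger_le_one _ _).trans ?_
    exact one_le_mul_of_one_le_of_one_le (le_max_left _ _) (Real.one_le_rpow hk1 (by norm_num))
  · obtain ⟨l, rfl⟩ : ∃ l, n = k + (l + 1) := ⟨n - k - 1, by omega⟩
    -- The squared distance calls for the moment of order `2a/d`; the final square root restores the
    -- exponent `a/d`.
    have h := hellinger_lawSn_sq_le hd hf hg.pos hk l hkn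
      (b := fun r => ENNReal.ofReal (K ^ 2) * ballMass Q x₀ r ^ (a / d * 2))
      (by have := measurable_ballMass Q x₀; fun_prop)
      (fun r hr => by
        rw [ENNReal.ofReal_pow (hellinger_nonneg _ _), ENNReal.ofReal_pow hK, ENNReal.rpow_mul,
          ENNReal.rpow_ofNat, ← mul_pow]
        gcongr
        exact hKb r hr)
      (c := K ^ 2 * (C * ((k : ℝ) / (k + (l + 1) : ℕ)) ^ (a / d * 2))) (by positivity)
      (by
        have := measurable_ballMass_minDist Q x₀ l
        rw [lintegral_const_mul _ (by fun_prop), ENNReal.ofReal_mul (by positivity)]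
        gcongr
        exact hCb k l hk)
    set t := (k : ℝ) / (k + (l + 1) : ℕ)
    have ht : 0 ≤ t := by positivity
    have hsq : hellinger (lawSn Q x₀ hkn) (lawS (condLaw ν f x₀) k)
        ≤ √(K ^ 2 * C) * ((k : ℝ) ^ (1 / 2 : ℝ) * t ^ (a / d)) := by
      refine le_of_sq_le_sq (h.trans_eq ?_) (by positivity)
      rw [mul_pow, mul_pow, Real.sq_sqrt (by positivity), ← Real.sqrt_eq_rpow,
        Real.sq_sqrt (by positivity), Real.rpow_mul ht, Real.rpow_two]
      ring
    exact hsq.trans (mul_le_mul_of_nonneg_right (le_max_right _ _) (by positivity))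

theorem exists_tvDist_lawSn_le (hd : 0 < d) (hf : IsJointDensity Q ν f) {𝒳 : Set E}
    (h𝒳 : MeasurableSet 𝒳) {x₀ : E} (hg : LocallyRegular 𝒳 (marginalDensity ν f) x₀) {a : ℝ}
    (ha : 0 ≤ a) (hTV : (fun r : ℝ => tvDist (localLaw Q x₀ r) (condLaw ν f x₀))
      =O[𝓝[>] 0] fun r : ℝ => r ^ a) :
    ∃ C : ℝ, 0 ≤ C ∧ ∀ (n k : ℕ) (_ : 1 ≤ k) (hkn : k ≤ n),
      tvDist (lawSn Q x₀ hkn) (lawS (condLaw ν f x₀) k)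
        ≤ C * ((k : ℝ) * ((k : ℝ) / (n : ℝ)) ^ (a / (d : ℝ))) := by
  have hP := isProbabilityMeasure_condLaw hf.nonneg hg.pos
  obtain ⟨K, hK, hKb⟩ := exists_ofReal_le_ballMass_rpow hd hf h𝒳 hg
    (D := fun r => tvDist (localLaw Q x₀ r) (condLaw ν f x₀))
    (fun r => tvDist_nonneg _ _) (fun r => tvDist_le_one _ _) ha hTV
  obtain ⟨C, hC, hCb⟩ := exists_lintegral_ballMass_rpow_le hd hf x₀ (p := a / d) (by positivity)
  refine ⟨max 1 (K * C), by positivity, fun n k hk hkn => ?_⟩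
  have hk1 : (1 : ℝ) ≤ k := by exact_mod_cast hk
  rcases hkn.eq_or_lt with rfl | hlt
  · rw [div_self (by positivity), Real.one_rpow, mul_one]
    exact (tvDist_le_one _ _).trans (one_le_mul_of_one_le_of_one_le (le_max_left _ _) hk1)
  · obtain ⟨l, rfl⟩ : ∃ l, n = k + (l + 1) := ⟨n - k - 1, by omega⟩
    have h := tvDist_lawSn_le hd hf x₀ (condLaw ν f x₀) hk l hkn
      (b := fun r => ENNReal.ofReal K * ballMass Q x₀ r ^ (a / d))
      (by have := measurable_ballMass Q x₀; fun_prop) hKb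
      (c := K * (C * ((k : ℝ) / (k + (l + 1) : ℕ)) ^ (a / d))) (by positivity)
      (by
        have := measurable_ballMass_minDist Q x₀ l
        rw [lintegral_const_mul _ (by fun_prop), ENNReal.ofReal_mul hK]
        gcongr
        exact hCb k l hk)
    refine h.trans ?_
    calc (k : ℝ) * (K * (C * ((k : ℝ) / (k + (l + 1) : ℕ)) ^ (a / d)))
        = K * C * (k * ((k : ℝ) / (k + (l + 1) : ℕ)) ^ (a / d)) := by ring
      _ ≤ _ := mul_le_mul_of_nonneg_right (le_max_right _ _) (by positivity)

end InducedOrder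

end

theorem theorem2 {d m : ℕ} (hd : 0 < d)
    (Q : Measure (EuclideanSpace ℝ (Fin d) × EuclideanSpace ℝ (Fin m))) [IsProbabilityMeasure Q]
    (ν : Measure (EuclideanSpace ℝ (Fin m))) [SigmaFinite ν]
    (f : EuclideanSpace ℝ (Fin d) → EuclideanSpace ℝ (Fin m) → ℝ)
    (hf : InducedOrder.IsJointDensity Q ν f)
    (𝒳 : Set (EuclideanSpace ℝ (Fin d))) (h𝒳 : MeasurableSet 𝒳) (hX : ∀ᵐ z ∂Q, z.1 ∈ 𝒳)
    (x₀ : EuclideanSpace ℝ (Fin d)) (hx₀ : x₀ ∈ 𝒳)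
    (hg : InducedOrder.LocallyRegular 𝒳 (InducedOrder.marginalDensity ν f) x₀)
    (a_h a_tv : ℝ) (ha_h : 0 ≤ a_h) (ha_tv : 0 ≤ a_tv)
    (hH : (fun r : ℝ => InducedOrder.hellinger (InducedOrder.localLaw Q x₀ r)
      (InducedOrder.condLaw ν f x₀)) =O[𝓝[>] 0] (fun r : ℝ => r ^ a_h))
    (hTV : (fun r : ℝ => InducedOrder.tvDist (InducedOrder.localLaw Q x₀ r)
      (InducedOrder.condLaw ν f x₀)) =O[𝓝[>] 0] (fun r : ℝ => r ^ a_tv)) :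
    (∃ C : ℝ, ∀ (n k : ℕ) (_ : 1 ≤ k) (hkn : k ≤ n),
      InducedOrder.hellinger (InducedOrder.lawSn Q x₀ hkn)
          (InducedOrder.lawS (InducedOrder.condLaw ν f x₀) k)
        ≤ C * ((k : ℝ) ^ (1 / 2 : ℝ) * ((k : ℝ) / (n : ℝ)) ^ (a_h / (d : ℝ)))) ∧
    (∃ C : ℝ, ∀ (n k : ℕ) (_ : 1 ≤ k) (hkn : k ≤ n),
      InducedOrder.tvDist (InducedOrder.lawSn Q x₀ hkn)
          (InducedOrder.lawS (InducedOrder.condLaw ν f x₀) k)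
        ≤ C * min ((k : ℝ) * ((k : ℝ) / (n : ℝ)) ^ (a_tv / (d : ℝ)))
            ((k : ℝ) ^ (1 / 2 : ℝ) * ((k : ℝ) / (n : ℝ)) ^ (a_h / (d : ℝ)))) := by
  have hP := InducedOrder.isProbabilityMeasure_condLaw hf.nonneg hg.pos
  obtain ⟨C₁, hC₁, h₁⟩ := InducedOrder.exists_hellinger_lawSn_le hd hf h𝒳 hg ha_h hH
  obtain ⟨C₂, hC₂, h₂⟩ := InducedOrder.exists_tvDist_lawSn_le hd hf h𝒳 hg ha_tv hTV
  refine ⟨⟨C₁, h₁⟩, max C₂ (3 * C₁), fun n k hk hkn => ?_⟩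
  rw [mul_min_of_nonneg _ _ (by positivity)]
  refine le_min ((h₂ n k hk hkn).trans ?_) ((InducedOrder.tvDist_le_hellinger _ _).trans ?_)
  · exact mul_le_mul_of_nonneg_right (le_max_left _ _) (by positivity)
  · refine (mul_le_mul_of_nonneg_left (h₁ n k hk hkn) (by norm_num)).trans ?_
    rw [← mul_assoc]
    exact mul_le_mul_of_nonneg_right (le_max_right _ _) (by positivity)
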